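/- Let $a>0$ and let $T\subset\mathbb{R}^2$ be the open isosceles right triangle with vertices $A,B,C$, with right angle at $A$ and legs $|AB|=|AC|=a$ (so that its area is $a^2/2$). Consider the Dirichlet eigenvalues of $T$, that is, the real $\mu$ for which $\Delta u+\mu u=0$ in $T$ ($\Delta=\partial_x^2+\partial_y^2$) has a non-zero solution $u\in H^2(T)\cap H^1_0(T)$; the multiplicity of $\mu$ is the dimension of the space of such solutions. All eigenvalues are positive and of finite multiplicity. The spectral zeta function $\zeta(s)=\sum_{\mu}\mu^{-s}$ (eigenvalues counted with multiplicity) converges for $\operatorname{Re}s>1$, has a unique meromorphic continuation to $\mathbb{C}$, and this continuation is holomorphic at $s=0$. The zeta-regularized determinant of $T$ is $e^{-\zeta'(0)}$, where $\zeta'(0)$ is equivalently given by $$\zeta'(0)=\frac{\log(4a^3)}{4}+\frac{\pi}{24}+\frac12\sum_{n=1}^\infty\frac{1}{n\,e^{2\pi n}}\sum_{d\mid n}d,$$ $$\zeta'(0)=\frac14\log\!\left(\frac{4a^3}{|\eta(i)|^2}\right)=\frac{\log(4a^3)}{4}+\frac{\pi}{24}-\frac12\sum_{n=1}^\infty\log\!\left(1-e^{-2\pi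 n}\right),$$ where both series converge and $\eta(\tau)=e^{\pi i\tau/12}\prod_{n=1}^\infty\bigl(1-e^{2\pi i n\tau}\bigr)$ $(\operatorname{Im}\tau>0)$ is the Dedekind eta function. -/

import Mathlib

open MeasureTheory Filter Topology TopologicalSpace
open scoped ContDiff Distributions EuclideanGeometry

namespace DirichletLaplacian

/-- The Euclidean plane. -/
abbrev Plane : Type := EuclideanSpace ℝ (Fin 2)

/-- The real Hilbert space `L²(Ω)`. -/
abbrev L2 (Ω : Opens Plane) : Type := Lp ℝ 2 (volume.restrict (Ω : Set Plane))

/-- `g` is the weak derivative of `u` in the direction `v` on `Ω`: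
`∫_Ω u ∂_v φ = - ∫_Ω g φ` for every test function `φ ∈ C_c^∞(Ω)`. -/
def HasWeakDeriv {Ω : Opens Plane} (v : Plane) (u g : L2 Ω) : Prop :=
  ∀ φ : 𝓓(Ω, ℝ),
    ∫ x in (Ω : Set Plane), u x * fderiv ℝ φ x v = - ∫ x in (Ω : Set Plane), g x * φ x

/-- The Sobolev space `H^k(Ω)`: `H^0(Ω) = L²(Ω)`, and `u ∈ H^{k+1}(Ω)` if all weak first
derivatives of `u` exist and lie in `H^k(Ω)`. -/
def MemH {Ω : Opens Plane} : ℕ → L2 Ω → Prop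
  | 0, _ => True
  | k + 1, u => ∀ v : Plane, ∃ g : L2 Ω, HasWeakDeriv v u g ∧ MemH k g

/-- The Dirichlet boundary condition, in the sense of Sobolev spaces: `u ∈ H^1_0(Ω)`, that is,
`u` is a limit of test functions with respect to the `H^1`-norm. -/
def MemH10 {Ω : Opens Plane} (u : L2 Ω) : Prop :=
  ∃ φ : ℕ → 𝓓(Ω, ℝ),
    Tendsto (fun k => eLpNorm (fun x => φ k x - u x) 2 (volume.restrict (Ω : Set Plane)))
      atTop (𝓝 0) ∧
    ∀ v : Plane, ∃ g : L2 Ω, HasWeakDeriv v u g ∧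
      Tendsto (fun k => eLpNorm (fun x => fderiv ℝ (φ k) x v - g x) 2
        (volume.restrict (Ω : Set Plane))) atTop (𝓝 0)

/-- `f = Δ u`, where `Δ = ∂₁² + ∂₂²` is formed with weak derivatives in `L²(Ω)`. -/
def HasWeakLaplacian {Ω : Opens Plane} (u f : L2 Ω) : Prop :=
  ∃ g h : Fin 2 → L2 Ω,
    (∀ i, HasWeakDeriv (EuclideanSpace.single i 1) u (g i) ∧
      HasWeakDeriv (EuclideanSpace.single i 1) (g i) (h i)) ∧
    f = ∑ i, h i

section Linearity

variable {Ω : Opens Plane}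

lemma integrable_mul_testFunction (u : L2 Ω) (φ : 𝓓(Ω, ℝ)) :
    Integrable (fun x => u x * φ x) (volume.restrict (Ω : Set Plane)) :=
  (Lp.memLp u).integrable_mul
    (φ.continuous.memLp_of_hasCompactSupport (p := 2) φ.hasCompactSupport)

lemma integrable_mul_fderiv_testFunction (u : L2 Ω) (φ : 𝓓(Ω, ℝ)) (v : Plane) :
    Integrable (fun x => u x * fderiv ℝ φ x v) (volume.restrict (Ω : Set Plane)) := by
  have hc : Continuous fun x => fderiv ℝ φ x v :=
    (φ.contDiff.continuous_fderiv (by simp)).clm_apply continuous_const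
  have hs : HasCompactSupport fun x => fderiv ℝ φ x v :=
    φ.hasCompactSupport.fderiv_apply ℝ v
  exact (Lp.memLp u).integrable_mul (hc.memLp_of_hasCompactSupport (p := 2) hs)

lemma HasWeakDeriv.add {v : Plane} {u u' g g' : L2 Ω} (h : HasWeakDeriv v u g)
    (h' : HasWeakDeriv v u' g') : HasWeakDeriv v (u + u') (g + g') := by
  intro φ
  have e₁ : ∫ x in (Ω : Set Plane), (u + u' : L2 Ω) x * fderiv ℝ φ x v =
      ∫ x in (Ω : Set Plane), (u x * fderiv ℝ φ x v + u' x * fderiv ℝ φ x v) := by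
    refine integral_congr_ae ?_
    filter_upwards [Lp.coeFn_add u u'] with x hx
    rw [hx, Pi.add_apply, add_mul]
  have e₂ : ∫ x in (Ω : Set Plane), (g + g' : L2 Ω) x * φ x =
      ∫ x in (Ω : Set Plane), (g x * φ x + g' x * φ x) := by
    refine integral_congr_ae ?_
    filter_upwards [Lp.coeFn_add g g'] with x hx
    rw [hx, Pi.add_apply, add_mul]
  rw [e₁, e₂, integral_add (integrable_mul_fderiv_testFunction u φ v)
    (integrable_mul_fderiv_testFunction u' φ v), integral_add (integrable_mul_testFunction g φ)
    (integrable_mul_testFunction g' φ), h φ, h' φ]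
  ring

lemma HasWeakDeriv.smul {v : Plane} {u g : L2 Ω} (c : ℝ) (h : HasWeakDeriv v u g) :
    HasWeakDeriv v (c • u) (c • g) := by
  intro φ
  have e₁ : ∫ x in (Ω : Set Plane), (c • u : L2 Ω) x * fderiv ℝ φ x v =
      ∫ x in (Ω : Set Plane), c * (u x * fderiv ℝ φ x v) := by
    refine integral_congr_ae ?_
    filter_upwards [Lp.coeFn_smul c u] with x hx
    rw [hx, Pi.smul_apply, smul_eq_mul, mul_assoc]
  have e₂ : ∫ x in (Ω : Set Plane), (c • g : L2 Ω) x * φ x =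
      ∫ x in (Ω : Set Plane), c * (g x * φ x) := by
    refine integral_congr_ae ?_
    filter_upwards [Lp.coeFn_smul c g] with x hx
    rw [hx, Pi.smul_apply, smul_eq_mul, mul_assoc]
  rw [e₁, e₂, integral_const_mul, integral_const_mul, h φ]
  ring

lemma HasWeakDeriv.zero (v : Plane) : HasWeakDeriv v (0 : L2 Ω) 0 := by
  have h : HasWeakDeriv v ((0 : ℝ) • (0 : L2 Ω)) ((0 : ℝ) • (0 : L2 Ω)) := by
    intro φ
    have e₁ : ∫ x in (Ω : Set Plane), ((0 : ℝ) • (0 : L2 Ω) : L2 Ω) x * fderiv ℝ φ x v = 0 := by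
      rw [zero_smul]
      refine integral_eq_zero_of_ae ?_
      filter_upwards [Lp.coeFn_zero ℝ 2 (volume.restrict (Ω : Set Plane))] with x hx
      rw [hx]; simp
    have e₂ : ∫ x in (Ω : Set Plane), ((0 : ℝ) • (0 : L2 Ω) : L2 Ω) x * φ x = 0 := by
      rw [zero_smul]
      refine integral_eq_zero_of_ae ?_
      filter_upwards [Lp.coeFn_zero ℝ 2 (volume.restrict (Ω : Set Plane))] with x hx
      rw [hx]; simp
    rw [e₁, e₂, neg_zero]
  simpa using h

lemma MemH.add : ∀ {k : ℕ} {u u' : L2 Ω}, MemH k u → MemH k u' → MemH k (u + u')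
  | 0, _, _, _, _ => trivial
  | _ + 1, _, _, h, h' => fun v => by
    obtain ⟨g, hg, hk⟩ := h v
    obtain ⟨g', hg', hk'⟩ := h' v
    exact ⟨g + g', hg.add hg', hk.add hk'⟩

lemma MemH.smul (c : ℝ) : ∀ {k : ℕ} {u : L2 Ω}, MemH k u → MemH k (c • u)
  | 0, _, _ => trivial
  | _ + 1, _, h => fun v => by
    obtain ⟨g, hg, hk⟩ := h v
    exact ⟨c • g, hg.smul c, MemH.smul c hk⟩

lemma MemH.zero : ∀ k : ℕ, MemH k (0 : L2 Ω)
  | 0 => trivial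
  | k + 1 => fun v => ⟨0, HasWeakDeriv.zero v, MemH.zero k⟩

lemma tendsto_eLpNorm_add {f f' : ℕ → Plane → ℝ} {u u' : L2 Ω}
    (hf : ∀ k, AEStronglyMeasurable (f k) (volume.restrict (Ω : Set Plane)))
    (hf' : ∀ k, AEStronglyMeasurable (f' k) (volume.restrict (Ω : Set Plane)))
    (h : Tendsto (fun k => eLpNorm (fun x => f k x - u x) 2 (volume.restrict (Ω : Set Plane)))
      atTop (𝓝 0))
    (h' : Tendsto (fun k => eLpNorm (fun x => f' k x - u' x) 2
      (volume.restrict (Ω : Set Plane))) atTop (𝓝 0)) :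
    Tendsto (fun k => eLpNorm (fun x => f k x + f' k x - (u + u' : L2 Ω) x) 2
      (volume.restrict (Ω : Set Plane))) atTop (𝓝 0) := by
  have hs := h.add h'
  rw [add_zero] at hs
  refine tendsto_of_tendsto_of_tendsto_of_le_of_le tendsto_const_nhds hs
    (fun _ => zero_le) (fun k => ?_)
  have e : (fun x => f k x + f' k x - (u + u' : L2 Ω) x) =ᵐ[volume.restrict (Ω : Set Plane)]
      (fun x => f k x - u x) + (fun x => f' k x - u' x) := by
    filter_upwards [Lp.coeFn_add u u'] with x hx
    rw [hx]
    simp only [Pi.add_apply]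
    ring
  rw [eLpNorm_congr_ae e]
  exact eLpNorm_add_le ((hf k).sub (Lp.aestronglyMeasurable u))
    ((hf' k).sub (Lp.aestronglyMeasurable u')) (by norm_num)

lemma tendsto_eLpNorm_smul (c : ℝ) {f : ℕ → Plane → ℝ} {u : L2 Ω}
    (h : Tendsto (fun k => eLpNorm (fun x => f k x - u x) 2 (volume.restrict (Ω : Set Plane)))
      atTop (𝓝 0)) :
    Tendsto (fun k => eLpNorm (fun x => c * f k x - (c • u : L2 Ω) x) 2
      (volume.restrict (Ω : Set Plane))) atTop (𝓝 0) := by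
  have hs := ENNReal.Tendsto.const_mul (a := ‖c‖ₑ) h (Or.inr enorm_ne_top)
  rw [mul_zero] at hs
  refine hs.congr fun k => ?_
  have e : (fun x => c * f k x - (c • u : L2 Ω) x) =ᵐ[volume.restrict (Ω : Set Plane)]
      c • (fun x => f k x - u x) := by
    filter_upwards [Lp.coeFn_smul c u] with x hx
    rw [hx]
    simp only [Pi.smul_apply, smul_eq_mul]
    ring
  rw [eLpNorm_congr_ae e, eLpNorm_const_smul]

lemma continuous_fderiv_testFunction (φ : 𝓓(Ω, ℝ)) (v : Plane) :
    Continuous fun x => fderiv ℝ φ x v :=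
  (φ.contDiff.continuous_fderiv (by simp)).clm_apply continuous_const

lemma differentiable_testFunction (φ : 𝓓(Ω, ℝ)) : Differentiable ℝ φ :=
  φ.contDiff.differentiable (by simp)

lemma MemH10.add {u u' : L2 Ω} (h : MemH10 u) (h' : MemH10 u') : MemH10 (u + u') := by
  obtain ⟨φ, hφ, hd⟩ := h
  obtain ⟨φ', hφ', hd'⟩ := h'
  refine ⟨fun k => φ k + φ' k, ?_, fun v => ?_⟩
  · exact tendsto_eLpNorm_add (fun k => (φ k).continuous.aestronglyMeasurable)
      (fun k => (φ' k).continuous.aestronglyMeasurable) hφ hφ'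
  · obtain ⟨g, hg, ht⟩ := hd v
    obtain ⟨g', hg', ht'⟩ := hd' v
    refine ⟨g + g', hg.add hg', ?_⟩
    refine (tendsto_eLpNorm_add
      (fun k => (continuous_fderiv_testFunction (φ k) v).aestronglyMeasurable)
      (fun k => (continuous_fderiv_testFunction (φ' k) v).aestronglyMeasurable) ht ht').congr
      fun k => ?_
    congr 1
    funext x
    have e : fderiv ℝ (⇑(φ k + φ' k)) x = fderiv ℝ (φ k) x + fderiv ℝ (φ' k) x :=
      fderiv_add (differentiable_testFunction (φ k) x) (differentiable_testFunction (φ' k) x)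
    rw [e]
    rfl

lemma MemH10.smul (c : ℝ) {u : L2 Ω} (h : MemH10 u) : MemH10 (c • u) := by
  obtain ⟨φ, hφ, hd⟩ := h
  refine ⟨fun k => c • φ k, ?_, fun v => ?_⟩
  · exact tendsto_eLpNorm_smul c hφ
  · obtain ⟨g, hg, ht⟩ := hd v
    refine ⟨c • g, hg.smul c, (tendsto_eLpNorm_smul c ht).congr fun k => ?_⟩
    congr 1
    funext x
    have e : fderiv ℝ (⇑(c • φ k)) x = c • fderiv ℝ (φ k) x :=
      fderiv_const_smul (differentiable_testFunction (φ k) x) c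
    rw [e]
    rfl

lemma MemH10.zero : MemH10 (0 : L2 Ω) := by
  have e0 : ∀ᵐ x ∂(volume.restrict (Ω : Set Plane)), (0 : L2 Ω) x = 0 := by
    filter_upwards [Lp.coeFn_zero ℝ 2 (volume.restrict (Ω : Set Plane))] with x hx
    rw [hx]; rfl
  refine ⟨fun _ => 0, ?_, fun v => ⟨0, HasWeakDeriv.zero v, ?_⟩⟩
  · refine tendsto_const_nhds.congr fun k => ?_
    symm
    refine (eLpNorm_congr_ae (g := fun _ => (0 : ℝ)) ?_).trans (by simp)
    filter_upwards [e0] with x hx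
    rw [hx]; simp
  · refine tendsto_const_nhds.congr fun k => ?_
    symm
    refine (eLpNorm_congr_ae (g := fun _ => (0 : ℝ)) ?_).trans (by simp)
    filter_upwards [e0] with x hx
    rw [hx]
    have : fderiv ℝ (⇑(0 : 𝓓(Ω, ℝ))) x = 0 := fderiv_const_apply (0 : ℝ)
    rw [this]; simp

lemma HasWeakLaplacian.add {u u' f f' : L2 Ω} (h : HasWeakLaplacian u f)
    (h' : HasWeakLaplacian u' f') : HasWeakLaplacian (u + u') (f + f') := by
  obtain ⟨g, k, hk, rfl⟩ := h
  obtain ⟨g', k', hk', rfl⟩ := h'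
  exact ⟨fun i => g i + g' i, fun i => k i + k' i,
    fun i => ⟨(hk i).1.add (hk' i).1, (hk i).2.add (hk' i).2⟩, Finset.sum_add_distrib.symm⟩

lemma HasWeakLaplacian.smul (c : ℝ) {u f : L2 Ω} (h : HasWeakLaplacian u f) :
    HasWeakLaplacian (c • u) (c • f) := by
  obtain ⟨g, k, hk, rfl⟩ := h
  exact ⟨fun i => c • g i, fun i => c • k i,
    fun i => ⟨(hk i).1.smul c, (hk i).2.smul c⟩, Finset.smul_sum⟩

lemma HasWeakLaplacian.zero : HasWeakLaplacian (0 : L2 Ω) 0 :=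
  ⟨fun _ => 0, fun _ => 0, fun _ => ⟨HasWeakDeriv.zero _, HasWeakDeriv.zero _⟩, by simp⟩

end Linearity

/-- The space of solutions `u ∈ H²(Ω)` of `Δ u + μ u = 0` in `Ω` with the Dirichlet boundary
condition. -/
def eigenspace (Ω : Opens Plane) (μ : ℝ) : Submodule ℝ (L2 Ω) where
  carrier := {u | MemH 2 u ∧ MemH10 u ∧ ∃ f : L2 Ω, HasWeakLaplacian u f ∧ f + μ • u = 0}
  zero_mem' := ⟨MemH.zero 2, MemH10.zero, 0, HasWeakLaplacian.zero, by simp⟩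
  add_mem' := by
    rintro u u' ⟨h, h₀, f, hf, e⟩ ⟨h', h₀', f', hf', e'⟩
    refine ⟨h.add h', h₀.add h₀', f + f', hf.add hf', ?_⟩
    rw [smul_add, add_add_add_comm, e, e', add_zero]
  smul_mem' := by
    rintro c u ⟨h, h₀, f, hf, e⟩
    refine ⟨h.smul c, h₀.smul c, c • f, hf.smul c, ?_⟩
    rw [smul_comm μ c u, ← smul_add, e, smul_zero]

/-- The set of Dirichlet eigenvalues of `Ω`. -/
def spectrum (Ω : Opens Plane) : Set ℝ := {μ | eigenspace Ω μ ≠ ⊥}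

/-- The multiplicity of `μ` as a Dirichlet eigenvalue of `Ω`. -/
noncomputable def multiplicity (Ω : Opens Plane) (μ : ℝ) : ℕ :=
  Module.finrank ℝ (eigenspace Ω μ)

/-- `Z` is the spectral zeta function of the Dirichlet Laplacian of `Ω`: for `Re s > 1` it is the
sum of the convergent series `∑ μ^{-s}` over all eigenvalues, counted with multiplicity, and it is
meromorphic on the whole complex plane. The normal form only fixes the values at the isolated
singularities: removable singularities are filled in, and the value at a pole is `0`. -/
structure IsSpectralZeta (Ω : Opens Plane) (Z : ℂ → ℂ) : Prop where
  hasSum : ∀ s : ℂ, 1 < s.re →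
    HasSum (fun μ : spectrum Ω => (multiplicity Ω μ : ℂ) * ((μ : ℝ) : ℂ) ^ (-s)) (Z s)
  meromorphic : MeromorphicNFOn Z Set.univ

open Classical in
/-- The spectral zeta function of the Dirichlet Laplacian of `Ω` (zero if there is none). -/
noncomputable def spectralZeta (Ω : Opens Plane) : ℂ → ℂ :=
  if h : ∃ Z, IsSpectralZeta Ω Z then h.choose else 0

/-- The zeta-regularized determinant `e^{-ζ'(0)}` of the Dirichlet Laplacian of `Ω`. -/
noncomputable def zetaDet (Ω : Opens Plane) : ℂ :=
  Complex.exp (-deriv (spectralZeta Ω) 0)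

/-- The open triangle with vertices `A`, `B`, `C`. -/
def triangle (A B C : Plane) : Opens Plane :=
  ⟨interior (convexHull ℝ {A, B, C}), isOpen_interior⟩

end DirichletLaplacian

/-! Spectrum. In orthogonal coordinates scaled by `π / a` the triangle becomes `0 < y < x < π`, half
of a square. Sine products on the square that are antisymmetric under `x ↔ y` vanish on all three
sides, so `sin(mx) sin(ny) - sin(nx) sin(my)` with `m > n ≥ 1` is an eigenfunction for `(π/a)² (m² +
n²)`. An eigenfunction is orthogonal to the modes of every other eigenvalue by Green's formula
(`integral_mode_mul_eq_zero`). The modes are complete by Stone-Weierstrass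
(`eq_zero_of_integral_mode_eq_zero`). Hence each eigenspace is the span of its modes
(`eigenspace_eq_span`), with multiplicity the number of pairs (`multiplicity_eq`).

Continuation. The zeta function is `(a/π)^(2s)` times the sum of `(m² + n²)^(-s)` over `m > n`,
which is half of the sum over the quadrant minus the diagonal `2^(-s) ζ(2s)`. The quadrant sum is a
Mellin transform of `ψ²`, where `ψ = (θ - 1)/2`. Applying Jacobi's functional equation to only one
factor leaves the kernel `ψ(t) ψ(1/t)`, which decays rapidly at both ends and has the entire
transform `crossMellin`, plus multiples of `ψ` that give completed Riemann zeta values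
(`mellin_psi_sq`).

Value. Since `1/Γ(s)` vanishes to first order at `0`, the derivative there needs only `crossMellin
0`, the completed zeta value `π/6` at `-1`, and `ζ(0)`, `ζ'(0)`. At `s = 0` the terms of
`crossMellin` are Bessel integrals of order one half, hence elementary, with sum `∑ e^(-2πmn) / n`
(`crossMellin_zero`). Grouping this by the product `mn`, or summing over `n` first, gives the
divisor series and the logarithm of the eta product. -/

namespace DirichletLaplacian

open scoped Real
open Set

/-! ### Closed form of the Bessel integral of order one half. -/

section GaussianIntegral

/-- The Gaussian integral `∫_{-∞}^u e^{-x²} dx`. -/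
noncomputable def gaussPrimitive (u : ℝ) : ℝ := √π / 2 + ∫ x in (0 : ℝ)..u, Real.exp (-x ^ 2)

lemma hasDerivAt_gaussPrimitive (u : ℝ) :
    HasDerivAt gaussPrimitive (Real.exp (-u ^ 2)) u := by
  have hc : Continuous fun x : ℝ => Real.exp (-x ^ 2) := by fun_prop
  exact (hc.integral_hasStrictDerivAt 0 u).hasDerivAt.const_add _

lemma tendsto_gaussPrimitive_atTop : Tendsto gaussPrimitive atTop (𝓝 √π) := by
  have hi : IntegrableOn (fun x : ℝ => Real.exp (-x ^ 2)) (Ioi 0) := by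
    simpa using (integrable_exp_neg_mul_sq one_pos).integrableOn (s := Ioi 0)
  have h := intervalIntegral_tendsto_integral_Ioi 0 hi tendsto_id
  have e : ∫ x in Ioi (0 : ℝ), Real.exp (-x ^ 2) = √π / 2 := by
    simpa using integral_gaussian_Ioi 1
  rw [e] at h
  simpa [gaussPrimitive] using! h.const_add (√π / 2)

lemma gaussPrimitive_neg (u : ℝ) : gaussPrimitive (-u) = √π - gaussPrimitive u := by
  have h : ∫ x in (0 : ℝ)..(-u), Real.exp (-x ^ 2) = - ∫ x in (0 : ℝ)..u, Real.exp (-x ^ 2) := by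
    have := intervalIntegral.integral_comp_neg (a := u) (b := 0) (fun x : ℝ => Real.exp (-x ^ 2))
    simp only [neg_zero, neg_sq] at this
    rw [← this, intervalIntegral.integral_symm]
  simp only [gaussPrimitive, h]
  ring

lemma tendsto_gaussPrimitive_atBot : Tendsto gaussPrimitive atBot (𝓝 0) := by
  have h := (tendsto_gaussPrimitive_atTop.comp tendsto_neg_atBot_atTop).const_sub √π
  rw [sub_self] at h
  refine h.congr fun u => ?_
  simp [gaussPrimitive_neg]

/-- A primitive of `t^{-3/2} e^{-α² t - β² / t}` up to the factor `β`. -/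
noncomputable def besselPrimitive (α β t : ℝ) : ℝ :=
  Real.exp (-2 * α * β) * gaussPrimitive (α * √t - β / √t) +
    Real.exp (2 * α * β) * gaussPrimitive (-(α * √t + β / √t))

/-- Since `(α√t ∓ β/√t)² = α²t + β²/t ∓ 2αβ`, the prefactors turn both Gaussians into `e^(-α²t -
β²/t)`. In the sum of the inner derivatives the `α` terms cancel and `β t^(-3/2)` remains. -/
lemma hasDerivAt_besselPrimitive (α β : ℝ) {t : ℝ} (ht : 0 < t) :
    HasDerivAt (besselPrimitive α β)
      (β * (t ^ (-3 / 2 : ℝ) * Real.exp (-α ^ 2 * t - β ^ 2 / t))) t := by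
  have hs := Real.hasDerivAt_sqrt ht.ne'
  have hs0 : √t ≠ 0 := (Real.sqrt_pos.2 ht).ne'
  have hq : √t * √t = t := Real.mul_self_sqrt ht.le
  have hpow : t ^ (-3 / 2 : ℝ) = 1 / (t * √t) := by
    rw [show (-3 / 2 : ℝ) = -(1 + 1 / 2) by norm_num, Real.rpow_neg ht.le, Real.rpow_add ht,
      Real.rpow_one, Real.sqrt_eq_rpow, one_div (t * _)]
  have h1 := ((hasDerivAt_gaussPrimitive _).comp t
    ((hs.const_mul α).sub (hs.fun_inv hs0 |>.const_mul β))).const_mul (Real.exp (-2 * α * β))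
  have h2 := ((hasDerivAt_gaussPrimitive _).comp t
    ((hs.const_mul α).add (hs.fun_inv hs0 |>.const_mul β)).neg).const_mul (Real.exp (2 * α * β))
  have h := h1.add h2
  refine (h.congr_deriv ?_).congr_of_eventuallyEq (Eventually.of_forall fun x => ?_)
  · simp only [Pi.add_apply, Pi.sub_apply, Pi.neg_apply]
    rw [hpow]
    generalize √t = r at hs0 hq
    subst hq
    have e1 : Real.exp (-2 * α * β) * Real.exp (-(α * r - β * r⁻¹) ^ 2) =
        Real.exp (-α ^ 2 * (r * r) - β ^ 2 / (r * r)) := by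
      rw [← Real.exp_add]; congr 1; field_simp; ring
    have e2 : Real.exp (2 * α * β) * Real.exp (-(-(α * r + β * r⁻¹)) ^ 2) =
        Real.exp (-α ^ 2 * (r * r) - β ^ 2 / (r * r)) := by
      rw [← Real.exp_add]; congr 1; field_simp; ring
    rw [← mul_assoc, ← mul_assoc, e1, e2]
    field_simp
    ring
  · simp only [besselPrimitive, Pi.add_apply, Function.comp, Pi.sub_apply, Pi.neg_apply,
      div_eq_mul_inv]

lemma tendsto_besselPrimitive_zero {α β : ℝ} (hβ : 0 < β) :
    Tendsto (besselPrimitive α β) (𝓝[>] 0) (𝓝 0) := by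
  have hs : Tendsto (fun t : ℝ => √t) (𝓝[>] 0) (𝓝[>] 0) := by
    refine tendsto_nhdsWithin_iff.2 ⟨?_, ?_⟩
    · have := (Real.continuous_sqrt.tendsto 0)
      rw [Real.sqrt_zero] at this
      exact this.mono_left nhdsWithin_le_nhds
    · filter_upwards [self_mem_nhdsWithin] with t ht using Real.sqrt_pos.2 ht
  have ha : Tendsto (fun t : ℝ => α * √t) (𝓝[>] 0) (𝓝 (α * 0)) :=
    (hs.mono_right nhdsWithin_le_nhds).const_mul α
  have hb : Tendsto (fun t : ℝ => β / √t) (𝓝[>] 0) atTop := by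
    simpa [div_eq_mul_inv] using (tendsto_inv_nhdsGT_zero.comp hs).const_mul_atTop hβ
  have h1 : Tendsto (fun t : ℝ => α * √t - β / √t) (𝓝[>] 0) atBot := by
    simpa [sub_eq_add_neg] using ha.add_atBot (tendsto_neg_atTop_atBot.comp hb)
  have h2 : Tendsto (fun t : ℝ => -(α * √t + β / √t)) (𝓝[>] 0) atBot :=
    tendsto_neg_atTop_atBot.comp (ha.add_atTop hb)
  have h := ((tendsto_gaussPrimitive_atBot.comp h1).const_mul (Real.exp (-2 * α * β))).add
    ((tendsto_gaussPrimitive_atBot.comp h2).const_mul (Real.exp (2 * α * β)))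
  rwa [mul_zero, mul_zero, add_zero] at h

lemma tendsto_besselPrimitive_atTop {α β : ℝ} (hα : 0 < α) :
    Tendsto (besselPrimitive α β) atTop (𝓝 (Real.exp (-2 * α * β) * √π)) := by
  have ha : Tendsto (fun t : ℝ => α * √t) atTop atTop :=
    Real.tendsto_sqrt_atTop.const_mul_atTop hα
  have hb : Tendsto (fun t : ℝ => β / √t) atTop (𝓝 0) :=
    Real.tendsto_sqrt_atTop.const_div_atTop β
  have h1 : Tendsto (fun t : ℝ => α * √t - β / √t) atTop atTop := by
    simpa [sub_eq_add_neg] using ha.atTop_add hb.neg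
  have h2 : Tendsto (fun t : ℝ => -(α * √t + β / √t)) atTop atBot :=
    tendsto_neg_atTop_atBot.comp (ha.atTop_add hb)
  have h := ((tendsto_gaussPrimitive_atTop.comp h1).const_mul (Real.exp (-2 * α * β))).add
    ((tendsto_gaussPrimitive_atBot.comp h2).const_mul (Real.exp (2 * α * β)))
  rwa [mul_zero, add_zero] at h

/-- The integrand is nonnegative with an explicit primitive, so the limits of the primitive at both
ends give integrability and the value together. -/
lemma integral_rpow_mul_exp_aux {α β : ℝ} (hα : 0 < α) (hβ : 0 < β) :
    IntegrableOn (fun t : ℝ => β * (t ^ (-3 / 2 : ℝ) * Real.exp (-α ^ 2 * t - β ^ 2 / t))) (Ioi 0) ∧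
    ∫ t in Ioi (0 : ℝ), β * (t ^ (-3 / 2 : ℝ) * Real.exp (-α ^ 2 * t - β ^ 2 / t)) =
      Real.exp (-2 * α * β) * √π := by
  -- At `t = 0` division by zero gives the primitive a value that is not its limit; it is replaced
  -- by the right limit `0`.
  set g : ℝ → ℝ := Function.update (besselPrimitive α β) 0 0 with hg
  have hc : ContinuousWithinAt g (Ici 0) 0 := by
    rw [← continuousWithinAt_Ioi_iff_Ici]
    have : Tendsto g (𝓝[>] 0) (𝓝 0) := by
      refine (tendsto_besselPrimitive_zero (α := α) hβ).congr' ?_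
      filter_upwards [self_mem_nhdsWithin] with t ht
      simp [hg, (ne_of_gt ht : t ≠ 0)]
    simpa [ContinuousWithinAt, hg] using this
  have hd : ∀ x ∈ Ioi (0 : ℝ), HasDerivAt g
      (β * (x ^ (-3 / 2 : ℝ) * Real.exp (-α ^ 2 * x - β ^ 2 / x))) x := fun x hx => by
    refine (hasDerivAt_besselPrimitive α β hx).congr_of_eventuallyEq ?_
    filter_upwards [Ioi_mem_nhds (show (0 : ℝ) < x from hx)] with t ht
    simp [hg, (ne_of_gt ht : t ≠ 0)]
  have hp : ∀ x ∈ Ioi (0 : ℝ),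
      0 ≤ β * (x ^ (-3 / 2 : ℝ) * Real.exp (-α ^ 2 * x - β ^ 2 / x)) := fun x hx => by
    have : 0 < x := hx
    positivity
  have ht : Tendsto g atTop (𝓝 (Real.exp (-2 * α * β) * √π)) := by
    refine (tendsto_besselPrimitive_atTop hα).congr' ?_
    filter_upwards [Ioi_mem_atTop 0] with t ht
    simp [hg, (ne_of_gt ht : t ≠ 0)]
  refine ⟨integrableOn_Ioi_deriv_of_nonneg hc hd hp ht, ?_⟩
  rw [integral_Ioi_of_hasDerivAt_of_nonneg hc hd hp ht]
  simp [hg]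

lemma integrableOn_rpow_mul_exp {α β : ℝ} (hα : 0 < α) (hβ : 0 < β) :
    IntegrableOn (fun t : ℝ => t ^ (-3 / 2 : ℝ) * Real.exp (-α ^ 2 * t - β ^ 2 / t)) (Ioi 0) := by
  have := (integral_rpow_mul_exp_aux hα hβ).1.const_mul β⁻¹
  simpa only [← mul_assoc, inv_mul_cancel₀ hβ.ne', one_mul] using! this

lemma integral_rpow_mul_exp {α β : ℝ} (hα : 0 < α) (hβ : 0 < β) :
    ∫ t in Ioi (0 : ℝ), t ^ (-3 / 2 : ℝ) * Real.exp (-α ^ 2 * t - β ^ 2 / t) =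
      √π / β * Real.exp (-2 * α * β) := by
  have := (integral_rpow_mul_exp_aux hα hβ).2
  rw [integral_const_mul] at this
  rw [div_mul_eq_mul_div, eq_div_iff hβ.ne', mul_comm _ β, this, mul_comm]

end GaussianIntegral

/-! ### The theta function and the rapidly decaying kernel `ψ(t) ψ(1/t)`. -/

section ThetaKernel

open HurwitzZeta Asymptotics

/-- The function `ψ(t) = ∑_{m ≥ 1} e^{-π m² t}`. -/
noncomputable def psi (t : ℝ) : ℝ := (evenKernel 0 t - 1) / 2

lemma hasSum_psi {t : ℝ} (ht : 0 < t) :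
    HasSum (fun m : ℕ+ => Real.exp (-π * (m : ℝ) ^ 2 * t)) (psi t) := by
  have h := (hasSum_nat_cosKernel₀ 0 ht).div_const 2
  rw [psi, evenKernel_eq_cosKernel_of_zero]
  rw [← Equiv.pnatEquivNat.symm.hasSum_iff]
  refine h.congr_fun fun n => ?_
  simp

/-- Jacobi's functional equation for `θ = 1 + 2ψ`, solved for `ψ(1/t)`. -/
lemma psi_inv {t : ℝ} (ht : 0 < t) :
    psi (1 / t) = t ^ (1 / 2 : ℝ) * psi t + t ^ (1 / 2 : ℝ) / 2 - 1 / 2 := by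
  have h := evenKernel_functional_equation 0 t
  rw [← evenKernel_eq_cosKernel_of_zero] at h
  have hp : (0 : ℝ) < t ^ (1 / 2 : ℝ) := Real.rpow_pos_of_pos ht _
  simp only [psi, h]
  field_simp
  ring

/-- The symmetric kernel `ψ(t) ψ(1/t)`. -/
noncomputable def crossKernel (t : ℝ) : ℂ := ((psi t * psi (1 / t) : ℝ) : ℂ)

lemma continuousOn_psi : ContinuousOn psi (Ioi 0) :=
  ((continuousOn_evenKernel 0).sub continuousOn_const).div_const 2

lemma continuousOn_crossKernel : ContinuousOn crossKernel (Ioi 0) := by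
  refine Complex.continuous_ofReal.comp_continuousOn (continuousOn_psi.mul ?_)
  refine continuousOn_psi.comp (continuousOn_const.div continuousOn_id fun x hx => ne_of_gt hx) ?_
  intro x hx
  exact one_div_pos.2 (show (0 : ℝ) < x from hx)

lemma isBigO_psi_atTop : ∃ p : ℝ, 0 < p ∧ psi =O[atTop] fun t => Real.exp (-p * t) := by
  obtain ⟨p, hp, h⟩ := isBigO_atTop_evenKernel_sub 0
  refine ⟨p, hp, ?_⟩
  simp only [if_true] at h
  refine (h.const_mul_left (2⁻¹ : ℝ)).congr' (Eventually.of_forall fun t => ?_) EventuallyEq.rfl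
  rw [psi, div_eq_inv_mul]

lemma isBigO_psi_inv_atTop : (fun t => psi (1 / t)) =O[atTop] fun t : ℝ => t ^ (1 / 2 : ℝ) := by
  obtain ⟨p, hp, h⟩ := isBigO_psi_atTop
  have h0 : psi =O[atTop] fun _ => (1 : ℝ) := by
    refine h.trans (IsBigO.of_bound 1 ?_)
    filter_upwards [Ici_mem_atTop 0] with t ht
    have : -p * t ≤ 0 := by nlinarith [show (0 : ℝ) ≤ t from ht]
    simpa using this
  have h1 : (fun t : ℝ => t ^ (1 / 2 : ℝ) * psi t) =O[atTop] fun t : ℝ => t ^ (1 / 2 : ℝ) := by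
    simpa using (isBigO_refl (fun t : ℝ => t ^ (1 / 2 : ℝ)) atTop).mul h0
  have h2 : (fun t : ℝ => t ^ (1 / 2 : ℝ) / 2) =O[atTop] fun t : ℝ => t ^ (1 / 2 : ℝ) := by
    simpa [div_eq_inv_mul] using
      (isBigO_refl (fun t : ℝ => t ^ (1 / 2 : ℝ)) atTop).const_mul_left (2⁻¹ : ℝ)
  have h3 : (fun _ : ℝ => (1 / 2 : ℝ)) =O[atTop] fun t : ℝ => t ^ (1 / 2 : ℝ) := by
    refine IsBigO.of_bound 1 ?_
    filter_upwards [Ici_mem_atTop 1] with t ht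
    have : (1 : ℝ) ≤ t ^ (1 / 2 : ℝ) := Real.one_le_rpow ht (by norm_num)
    rw [Real.norm_of_nonneg (by norm_num), Real.norm_of_nonneg (by linarith)]
    linarith
  refine ((h1.add h2).sub h3).congr' ?_ EventuallyEq.rfl
  filter_upwards [Ioi_mem_atTop 0] with t ht
  rw [psi_inv ht]

/-- The exponential decay of `ψ(t)` absorbs the growth `√t` of `ψ(1/t)`. -/
lemma isBigO_crossKernel_atTop (b : ℝ) : crossKernel =O[atTop] fun t : ℝ => t ^ b := by
  obtain ⟨p, hp, h⟩ := isBigO_psi_atTop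
  have h1 : psi =O[atTop] fun t : ℝ => t ^ (b - 1 / 2) :=
    h.trans (isLittleO_exp_neg_mul_rpow_atTop hp _).isBigO
  have h2 := h1.mul isBigO_psi_inv_atTop
  have h3 : crossKernel =O[atTop] fun t => psi t * psi (1 / t) := by
    refine IsBigO.of_bound 1 (Eventually.of_forall fun t => ?_)
    rw [crossKernel, Complex.norm_real, one_mul]
  refine (h3.trans h2).congr' EventuallyEq.rfl ?_
  filter_upwards [Ioi_mem_atTop 0] with t ht
  rw [← Real.rpow_add ht]
  congr 1
  ring

/-- The kernel is invariant under `t ↦ 1/t`, so the decay at infinity transfers to `0`. -/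
lemma isBigO_crossKernel_zero (b : ℝ) : crossKernel =O[𝓝[>] 0] fun t : ℝ => t ^ b := by
  have h := (isBigO_crossKernel_atTop (-b)).comp_tendsto tendsto_inv_nhdsGT_zero
  refine h.congr' (Eventually.of_forall fun t => ?_) ?_
  · simp [crossKernel, mul_comm]
  · filter_upwards [self_mem_nhdsWithin] with t ht
    simp only [Function.comp]
    rw [Real.inv_rpow (le_of_lt ht), ← Real.rpow_neg (le_of_lt ht), neg_neg]

/-- The entire part `K(s) = ∫_0^∞ t^{s - 3/2} ψ(t) ψ(1/t) dt` of the completed lattice sum. -/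
noncomputable def crossMellin (s : ℂ) : ℂ := mellin crossKernel (s - 1 / 2)

lemma mellinConvergent_crossKernel (s : ℂ) : MellinConvergent crossKernel s :=
  mellinConvergent_of_isBigO_rpow
    (continuousOn_crossKernel.locallyIntegrableOn measurableSet_Ioi)
    (isBigO_crossKernel_atTop _) (lt_add_one s.re) (isBigO_crossKernel_zero _) (sub_one_lt s.re)

/-- Decay faster than every power at both ends makes the strip of convergence the whole plane. -/
lemma differentiable_crossMellin : Differentiable ℂ crossMellin := by
  have h : Differentiable ℂ (mellin crossKernel) := fun s =>
    mellin_differentiableAt_of_isBigO_rpow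
      (continuousOn_crossKernel.locallyIntegrableOn measurableSet_Ioi)
      (isBigO_crossKernel_atTop _) (lt_add_one s.re) (isBigO_crossKernel_zero _) (sub_one_lt s.re)
  exact h.comp (differentiable_id.sub_const _)

end ThetaKernel

end DirichletLaplacian

namespace DirichletLaplacian

open scoped Real
open Set

/-! ### Mellin transforms and the lattice sums over the quadrant and the octant. -/

section LatticeSum

open HurwitzZeta Asymptotics Complex

lemma isBigO_psi_zero : psi =O[𝓝[>] 0] fun t : ℝ => t ^ (-(1 / 2) : ℝ) := by
  refine (isBigO_psi_inv_atTop.comp_tendsto tendsto_inv_nhdsGT_zero).congr'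
    (Eventually.of_forall fun t => by simp) ?_
  filter_upwards [self_mem_nhdsWithin] with t ht
  simp only [Function.comp]
  rw [Real.inv_rpow (le_of_lt ht), ← Real.rpow_neg (le_of_lt ht)]

lemma mellinConvergent_psi {s : ℂ} (hs : 1 / 2 < s.re) :
    MellinConvergent (fun t => (psi t : ℂ)) s := by
  obtain ⟨p, hp, h⟩ := isBigO_psi_atTop
  refine mellinConvergent_of_isBigO_rpow_exp hp
    ((continuous_ofReal.comp_continuousOn continuousOn_psi).locallyIntegrableOn measurableSet_Ioi)
    (IsBigO.trans ?_ h) (IsBigO.trans ?_ isBigO_psi_zero) hs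
  all_goals exact IsBigO.of_bound 1 (Eventually.of_forall fun t => by simp)

lemma pnat_rpow_sq (m : ℕ+) (s : ℂ) : (((m : ℝ) ^ 2 : ℝ) : ℂ) ^ s = (m : ℂ) ^ (2 * s) := by
  have h : (0 : ℝ) ≤ (m : ℝ) := by positivity
  rw [two_mul, cpow_add _ _ (by simp), pow_two, ofReal_mul,
    mul_cpow_ofReal_nonneg h h]
  simp

lemma hasSum_pnat_zeta {s : ℂ} (hs : 1 < s.re) :
    HasSum (fun m : ℕ+ => 1 / (m : ℂ) ^ s) (riemannZeta s) := by
  have h := (summable_nat_add_iff 1).2 (Complex.summable_one_div_nat_cpow.2 hs)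
  rw [zeta_eq_tsum_one_div_nat_add_one_cpow hs, ← Equiv.pnatEquivNat.symm.hasSum_iff]
  have h2 := h.hasSum
  simp only [Nat.cast_add, Nat.cast_one] at h2
  refine h2.congr_fun fun n => ?_
  simp

/-- Riemann's computation: termwise integration of `ψ` produces `π^(-s) Γ(s) ζ(2s)`. -/
lemma mellin_psi {s : ℂ} (hs : 1 / 2 < s.re) :
    mellin (fun t => (psi t : ℂ)) s = completedRiemannZeta (2 * s) := by
  have hs' : 1 < (2 * s).re := by simp; linarith
  have hσ : (1 : ℝ) < 2 * s.re := by linarith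
  have h : HasSum (fun i : ℕ+ => (π : ℂ) ^ (-s) * Gamma s * (1 : ℂ) / (((i : ℝ) ^ 2 : ℝ) : ℂ) ^ s)
      (mellin (fun t => (psi t : ℂ)) s) := by
    refine hasSum_mellin_pi_mul (a := fun _ : ℕ+ => (1 : ℂ)) (q := fun i : ℕ+ => (i : ℝ) ^ 2)
      (fun i => Or.inr (by positivity)) (by linarith) (fun t ht => ?_) ?_
    · simpa using! (hasSum_ofReal.2 (hasSum_psi ht))
    · have := (Real.summable_one_div_nat_rpow.2 hσ).comp_injective PNat.coe_injective
      refine this.congr fun i => ?_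
      simp only [Function.comp, norm_one]
      rw [Real.rpow_mul (by positivity), Real.rpow_two]
  have h2 := (hasSum_pnat_zeta hs').mul_left ((π : ℂ) ^ (-s) * Gamma s)
  rw [completedZeta_eq_tsum_of_one_lt_re hs', ← zeta_eq_tsum_one_div_nat_cpow hs',
    show -(2 * s) / 2 = -s by ring, show 2 * s / 2 = s by ring]
  refine h.unique (h2.congr_fun fun i => ?_)
  rw [pnat_rpow_sq]
  ring

/-- Because `m² + n² ≥ mn`, the series is dominated by a product of two convergent one-dimensional
series. -/
lemma summable_sum_sq_rpow {σ : ℝ} (hσ : 1 < σ) :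
    Summable fun p : ℕ+ × ℕ+ => 1 / ((p.1 : ℝ) ^ 2 + (p.2 : ℝ) ^ 2) ^ σ := by
  have h := (Real.summable_one_div_nat_rpow.2 hσ).comp_injective PNat.coe_injective
  have h2 := h.mul_of_nonneg h (fun _ => by simp only [Function.comp, Pi.zero_apply]; positivity)
    (fun _ => by simp only [Function.comp, Pi.zero_apply]; positivity)
  refine Summable.of_nonneg_of_le (fun p => by positivity) (fun p => ?_) h2
  have h1 : (0 : ℝ) < p.1 := by positivity
  have h3 : (0 : ℝ) < p.2 := by positivity
  simp only [Function.comp]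
  rw [div_mul_div_comm, one_mul, ← Real.mul_rpow h1.le h3.le]
  refine one_div_le_one_div_of_le (by positivity) (Real.rpow_le_rpow (by positivity) ?_ (by linarith))
  nlinarith [sq_nonneg ((p.1 : ℝ) - p.2)]

/-- The functional equation is used for one factor only, so that everything outside the decaying
kernel is linear in `ψ` and has a known Mellin transform. -/
lemma psi_sq {t : ℝ} (ht : 0 < t) :
    psi t * psi t = t ^ (-(1 / 2) : ℝ) * (psi t * psi (1 / t)) + t ^ (-(1 / 2) : ℝ) * psi t / 2
      - psi t / 2 := by
  have h := psi_inv ht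
  have hp : (0 : ℝ) < t ^ (1 / 2 : ℝ) := Real.rpow_pos_of_pos ht _
  rw [Real.rpow_neg ht.le, h]
  field_simp
  ring

lemma mellin_psi_sq {s : ℂ} (hs : 1 < s.re) :
    mellin (fun t => ((psi t * psi t : ℝ) : ℂ)) s = crossMellin s +
      completedRiemannZeta (2 * s - 1) / 2 - completedRiemannZeta (2 * s) / 2 := by
  have c1 : MellinConvergent (fun t : ℝ => (t : ℂ) ^ (-(1 / 2) : ℂ) • crossKernel t) s :=
    MellinConvergent.cpow_smul.2 (mellinConvergent_crossKernel _)
  have c2 : MellinConvergent (fun t : ℝ => (t : ℂ) ^ (-(1 / 2) : ℂ) • (psi t : ℂ)) s :=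
    MellinConvergent.cpow_smul.2 (mellinConvergent_psi (by simp; linarith))
  have c3 : MellinConvergent (fun t : ℝ => (psi t : ℂ)) s :=
    mellinConvergent_psi (by linarith)
  have h := (hasMellin_sub (hasMellin_add c1 (c2.div_const 2)).1 (c3.div_const 2)).2
  rw [(hasMellin_add c1 (c2.div_const 2)).2] at h
  simp only [mellin_div_const, mellin_cpow_smul] at h
  rw [mellin_psi (s := s + -(1 / 2)) (by simp; linarith), mellin_psi (s := s) (by linarith)] at h
  rw [crossMellin, sub_eq_add_neg s, show 2 * s - 1 = 2 * (s + -(1 / 2)) by ring, ← h]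
  refine setIntegral_congr_fun measurableSet_Ioi fun t ht => ?_
  have ht0 : (0 : ℝ) < t := ht
  have e : (t : ℂ) ^ (-(1 / 2) : ℂ) = ((t ^ (-(1 / 2) : ℝ) : ℝ) : ℂ) := by
    rw [ofReal_cpow ht0.le]; push_cast; rfl
  simp only [psi_sq ht0, e, crossKernel, smul_eq_mul]
  push_cast
  ring

/-- The continuation of `∑_{m, n ≥ 1} (m² + n²)^{-s}`. -/
noncomputable def quadrantZeta (s : ℂ) : ℂ :=
  (π : ℂ) ^ s * (Gamma s)⁻¹ * (crossMellin s + completedRiemannZeta (2 * s - 1) / 2) -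
    riemannZeta (2 * s) / 2

/-- Termwise integration of `ψ²`, divided by `π^(-s) Γ(s)`. The same gamma factor occurs in the
completed zeta function at `2s`, so that term reduces to `ζ(2s)`; the form of `quadrantZeta` is
thereby regular at `s = 0`. -/
lemma hasSum_quadrantZeta {s : ℂ} (hs : 1 < s.re) :
    HasSum (fun p : ℕ+ × ℕ+ => 1 / (((p.1 : ℝ) ^ 2 + (p.2 : ℝ) ^ 2 : ℝ) : ℂ) ^ s)
      (quadrantZeta s) := by
  have h : HasSum (fun p : ℕ+ × ℕ+ => (π : ℂ) ^ (-s) * Gamma s * (1 : ℂ) /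
      (((p.1 : ℝ) ^ 2 + (p.2 : ℝ) ^ 2 : ℝ) : ℂ) ^ s)
      (mellin (fun t => ((psi t * psi t : ℝ) : ℂ)) s) := by
    refine hasSum_mellin_pi_mul (a := fun _ : ℕ+ × ℕ+ => (1 : ℂ))
      (q := fun p : ℕ+ × ℕ+ => (p.1 : ℝ) ^ 2 + (p.2 : ℝ) ^ 2)
      (fun i => Or.inr (by positivity)) (by linarith) (fun t ht => ?_) ?_
    · have h1 := hasSum_psi ht
      have h2 := h1.mul h1 (h1.summable.mul_of_nonneg h1.summable
        (fun _ => (Real.exp_pos _).le) (fun _ => (Real.exp_pos _).le))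
      refine (hasSum_ofReal.2 h2).congr_fun fun p => ?_
      rw [one_mul, ← Real.exp_add]
      congr 2
      ring
    · simpa using summable_sum_sq_rpow hs
  have hG : Gamma s ≠ 0 := Gamma_ne_zero_of_re_pos (by linarith)
  have hpi : (π : ℂ) ^ s ≠ 0 := by simp [cpow_eq_zero_iff, Real.pi_ne_zero]
  have hs2 : 1 < (2 * s).re := by simp; linarith
  have hz : completedRiemannZeta (2 * s) = (π : ℂ) ^ (-s) * Gamma s * riemannZeta (2 * s) := by
    rw [completedZeta_eq_tsum_of_one_lt_re hs2, ← zeta_eq_tsum_one_div_nat_cpow hs2,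
      show -(2 * s) / 2 = -s by ring, show 2 * s / 2 = s by ring]
  rw [mellin_psi_sq hs, hz] at h
  have h3 := h.mul_left ((π : ℂ) ^ s * (Gamma s)⁻¹)
  have e : quadrantZeta s = (π : ℂ) ^ s * (Gamma s)⁻¹ * (crossMellin s +
      completedRiemannZeta (2 * s - 1) / 2 -
      (π : ℂ) ^ (-s) * Gamma s * riemannZeta (2 * s) / 2) := by
    rw [quadrantZeta, cpow_neg]
    field_simp
  rw [e]
  refine h3.congr_fun fun p => ?_
  rw [cpow_neg]
  field_simp

/-- The continuation of `∑_{m > n ≥ 1} (m² + n²)^{-s}`. -/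
noncomputable def octantZeta (s : ℂ) : ℂ :=
  (quadrantZeta s - (2 : ℂ) ^ (-s) * riemannZeta (2 * s)) / 2

/-- The quadrant splits into two open octants exchanged by the swap, which have equal sums, and the
diagonal. -/
lemma hasSum_strict_half {f : ℕ+ × ℕ+ → ℂ} {q d : ℂ} (hf : ∀ p, f p.swap = f p)
    (hq : HasSum f q) (hd : HasSum (fun m : ℕ+ => f (m, m)) d) :
    HasSum (fun p : {p : ℕ+ × ℕ+ // p.2 < p.1} => f p) ((q - d) / 2) := by
  let P : Set (ℕ+ × ℕ+) := {p | p.2 < p.1}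
  let N : Set (ℕ+ × ℕ+) := {p | p.1 < p.2}
  let D : Set (ℕ+ × ℕ+) := {p | p.1 = p.2}
  obtain ⟨x, hx⟩ : ∃ x, HasSum (fun p : P => f p) x := hq.summable.subtype P
  let eN : N ≃ P := (Equiv.prodComm ℕ+ ℕ+).subtypeEquiv fun p => Iff.rfl
  have hN : HasSum (fun p : N => f p) x := by
    rw [← eN.hasSum_iff] at hx
    exact hx.congr_fun fun p => (hf p).symm
  let eD : ℕ+ ≃ D := ⟨fun m => ⟨(m, m), rfl⟩, fun p => p.1.1, fun m => rfl, fun p => by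
    obtain ⟨⟨a, b⟩, h⟩ := p
    have : a = b := h
    subst this; rfl⟩
  have hD : HasSum (fun p : D => f p) d := by
    rw [← eD.hasSum_iff]
    exact hd
  have hPN : Disjoint P N :=
    Set.disjoint_left.2 fun p (h : p.2 < p.1) (h' : p.1 < p.2) => lt_asymm h h'
  have hPD : Disjoint (P ∪ N) D := Set.disjoint_left.2 fun p h h' =>
    h.elim (fun h : p.2 < p.1 => (ne_of_gt h) h') (fun h : p.1 < p.2 => (ne_of_lt h) h')
  have hU : P ∪ N ∪ D = Set.univ := Set.eq_univ_of_forall fun p => by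
    rcases lt_trichotomy p.1 p.2 with h | h | h
    · exact Or.inl (Or.inr h)
    · exact Or.inr h
    · exact Or.inl (Or.inl h)
  have hA := HasSum.add_disjoint (f := f) hPD (HasSum.add_disjoint (f := f) hPN hx hN) hD
  rw [hU] at hA
  have hA' : HasSum f (x + x + d) := (Equiv.Set.univ _).symm.hasSum_iff.2 hA
  have ex : (q - d) / 2 = x := by rw [hq.unique hA']; ring
  rw [ex]
  exact hx

lemma hasSum_octantZeta {s : ℂ} (hs : 1 < s.re) :
    HasSum (fun p : {p : ℕ+ × ℕ+ // p.2 < p.1} =>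
      1 / (((p.1.1 : ℝ) ^ 2 + (p.1.2 : ℝ) ^ 2 : ℝ) : ℂ) ^ s) (octantZeta s) := by
  have hs2 : 1 < (2 * s).re := by simp; linarith
  refine hasSum_strict_half
    (f := fun p => 1 / (((p.1 : ℝ) ^ 2 + (p.2 : ℝ) ^ 2 : ℝ) : ℂ) ^ s)
    (fun p => by simp only [Prod.fst_swap, Prod.snd_swap, add_comm]) (hasSum_quadrantZeta hs) ?_
  -- On the diagonal the form is `2m²`, which gives `2^(-s) ζ(2s)`.
  refine ((hasSum_pnat_zeta hs2).mul_left _).congr_fun fun m => ?_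
  rw [← two_mul, ofReal_mul, mul_cpow_ofReal_nonneg (by norm_num) (by positivity),
    pnat_rpow_sq, cpow_neg]
  simp [mul_comm]

end LatticeSum

end DirichletLaplacian

namespace DirichletLaplacian

open scoped Real
open Set

/-! ### Values and derivatives at `s = 0`, poles, and the identity theorem. -/

section SpecialValues

open Complex

/-- Comparison with `∑ r^(mn)` for `r = e^(-2π) < 1`. -/
lemma summable_lambert :
    Summable fun p : ℕ+ × ℕ+ => Real.exp (-2 * π * (p.1 * p.2)) / (p.2 : ℝ) := by
  have hr : ‖Real.exp (-2 * π)‖ < 1 := by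
    rw [Real.norm_of_nonneg (Real.exp_pos _).le, Real.exp_lt_one_iff]
    linarith [Real.pi_pos]
  refine Summable.of_nonneg_of_le (fun p => by positivity) (fun p => ?_) (summable_prod_mul_pow 0 hr)
  have h1 : (1 : ℝ) ≤ p.2 := by exact_mod_cast p.2.2
  rw [pow_zero, one_mul, ← Real.exp_nat_mul]
  refine (div_le_self (Real.exp_pos _).le h1).trans (le_of_eq ?_)
  push_cast
  congr 1
  ring

/-- At `s = 0` the power is `t^(-3/2)`, so each term of the double series is the integral of
`integral_rpow_mul_exp` with `α = √π m` and `β = √π n`. Its value is `e^(-2πmn) / n`, and positivity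
together with `summable_lambert` permits exchanging sum and integral. -/
lemma crossMellin_zero :
    crossMellin 0 = ((∑' p : ℕ+ × ℕ+, Real.exp (-2 * π * (p.1 * p.2)) / (p.2 : ℝ) : ℝ) : ℂ) := by
  set F : ℕ+ × ℕ+ → ℝ → ℝ := fun p t =>
    t ^ (-3 / 2 : ℝ) * Real.exp (-(√π * p.1) ^ 2 * t - (√π * p.2) ^ 2 / t) with hF
  have hpi : (0 : ℝ) < √π := Real.sqrt_pos.2 Real.pi_pos
  have hpos : ∀ m : ℕ+, 0 < √π * (m : ℝ) := fun m => by positivity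
  have hint : ∀ p, ∫ t in Ioi (0 : ℝ), F p t = Real.exp (-2 * π * (p.1 * p.2)) / (p.2 : ℝ) := by
    intro p
    rw [hF, integral_rpow_mul_exp (hpos _) (hpos _)]
    have : -2 * (√π * (p.1 : ℝ)) * (√π * p.2) = -2 * π * (p.1 * p.2) := by
      nth_rewrite 3 [← Real.mul_self_sqrt Real.pi_pos.le]; ring
    rw [this]
    field_simp
  have hnorm : ∀ p, ∫ t in Ioi (0 : ℝ), ‖F p t‖ = ∫ t in Ioi (0 : ℝ), F p t := fun p =>
    setIntegral_congr_fun measurableSet_Ioi fun t ht => by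
      have : (0 : ℝ) < t := ht
      exact Real.norm_of_nonneg (by positivity)
  have h := hasSum_integral_of_summable_integral_norm (μ := volume.restrict (Ioi (0 : ℝ))) (F := F)
    (fun p => integrableOn_rpow_mul_exp (hpos _) (hpos _))
    (by simp only [hnorm, hint]; exact summable_lambert)
  simp only [hint] at h
  rw [h.tsum_eq, crossMellin, mellin, ← integral_complex_ofReal]
  refine setIntegral_congr_fun measurableSet_Ioi fun t ht => ?_
  have ht0 : (0 : ℝ) < t := ht
  have hs : HasSum (fun p => F p t) (t ^ (-3 / 2 : ℝ) * (psi t * psi (1 / t))) := by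
    have h1 := hasSum_psi ht0
    have h2 := hasSum_psi (one_div_pos.2 ht0)
    have h3 := h1.mul h2 (h1.summable.mul_of_nonneg h2.summable
      (fun _ => (Real.exp_pos _).le) (fun _ => (Real.exp_pos _).le))
    refine (h3.mul_left _).congr_fun fun p => ?_
    simp only [hF]
    rw [← Real.exp_add, mul_pow, mul_pow, Real.sq_sqrt Real.pi_pos.le]
    congr 2
    field_simp
    ring
  have e : (t : ℂ) ^ (0 - 1 / 2 - 1 : ℂ) = ((t ^ (-3 / 2 : ℝ) : ℝ) : ℂ) := by
    rw [ofReal_cpow ht0.le]; push_cast; congr 1; norm_num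
  simp only [hs.tsum_eq, e, crossKernel, smul_eq_mul]
  push_cast
  ring

/-- From `1/Γ(s) = s/Γ(s + 1)` and `Γ(1) = 1`. -/
lemma hasDerivAt_inv_Gamma_zero : HasDerivAt (fun s : ℂ => (Gamma s)⁻¹) 1 0 := by
  have h : HasDerivAt (fun s : ℂ => s * (Gamma (s + 1))⁻¹)
      (1 * (Gamma (0 + 1))⁻¹ + 0 * deriv (fun s : ℂ => (Gamma (s + 1))⁻¹) 0) 0 :=
    (hasDerivAt_id (0 : ℂ)).mul
      ((differentiable_one_div_Gamma.comp (differentiable_id.add_const 1)) 0).hasDerivAt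
  refine (h.congr_deriv (by simp)).congr_of_eventuallyEq (Eventually.of_forall fun s => ?_)
  exact one_div_Gamma_eq_self_mul_one_div_Gamma_add_one s

/-- The reflection `s ↦ 1 - s` moves the point to `2`, where the value is `π⁻¹ ζ(2)`. -/
lemma completedRiemannZeta_neg_one : completedRiemannZeta (-1) = π / 6 := by
  have h := completedRiemannZeta_one_sub 2
  rw [show (1 : ℂ) - 2 = -1 by norm_num] at h
  rw [h]
  have h2 := riemannZeta_def_of_ne_zero (s := 2) two_ne_zero
  rw [riemannZeta_two, Gammaℝ_def, div_self two_ne_zero, Gamma_one, mul_one] at h2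
  have hp : (π : ℂ) ≠ 0 := ofReal_ne_zero.2 Real.pi_ne_zero
  rw [show (-2 / 2 : ℂ) = -1 by norm_num, cpow_neg_one] at h2
  field_simp at h2 ⊢
  linear_combination (-1 : ℂ) * h2

lemma hasDerivAt_riemannZeta_two_mul :
    HasDerivAt (fun s : ℂ => riemannZeta (2 * s)) (-log (2 * π)) 0 := by
  have h : HasDerivAt riemannZeta (deriv riemannZeta (2 * 0)) (2 * 0 : ℂ) :=
    (differentiableAt_riemannZeta (by simp)).hasDerivAt
  have h2 := h.comp (0 : ℂ) ((hasDerivAt_id (0 : ℂ)).const_mul 2)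
  refine h2.congr_deriv ?_
  rw [mul_zero, deriv_riemannZeta_zero]
  ring

lemma hasDerivAt_quadrantZeta_zero :
    HasDerivAt quadrantZeta (crossMellin 0 + π / 12 + log (2 * π) / 2) 0 := by
  have hp : (π : ℂ) ≠ 0 := ofReal_ne_zero.2 Real.pi_ne_zero
  have h1 : HasDerivAt (fun s : ℂ => (π : ℂ) ^ s) ((π : ℂ) ^ (0 : ℂ) * log π * 1) 0 :=
    (hasDerivAt_id (0 : ℂ)).const_cpow (Or.inl hp)
  -- Differentiability of the bracket suffices: its derivative is multiplied by `1/Γ(0) = 0`, so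
  -- only its value at `0` survives.
  have hd : DifferentiableAt ℂ
      (fun s : ℂ => crossMellin s + completedRiemannZeta (2 * s - 1) / 2) 0 := by
    refine (differentiable_crossMellin 0).add (DifferentiableAt.div_const ?_ 2)
    exact (differentiableAt_completedZeta (by norm_num) (by norm_num)).comp (0 : ℂ)
      ((differentiableAt_id.const_mul 2).sub_const 1)
  have h := ((h1.mul hasDerivAt_inv_Gamma_zero).mul hd.hasDerivAt).sub
    (hasDerivAt_riemannZeta_two_mul.div_const 2)
  refine h.congr_deriv ?_
  -- The default value `Gamma 0 = 0` has inverse `0`, which is the correct value of the entire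
  -- function `1/Γ` at its zero.
  simp [completedRiemannZeta_neg_one, Gamma_zero]
  ring

lemma quadrantZeta_zero : quadrantZeta 0 = 1 / 4 := by
  simp [quadrantZeta, riemannZeta_zero]
  norm_num

lemma octantZeta_zero : octantZeta 0 = 3 / 8 := by
  simp [octantZeta, quadrantZeta_zero, riemannZeta_zero]
  norm_num

lemma hasDerivAt_octantZeta_zero :
    HasDerivAt octantZeta
      (crossMellin 0 / 2 + π / 24 + 3 / 4 * log (2 * π) - log 2 / 4) 0 := by
  have h1 : HasDerivAt (fun s : ℂ => (2 : ℂ) ^ (-s)) ((2 : ℂ) ^ (-0 : ℂ) * log 2 * (-1)) 0 :=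
    ((hasDerivAt_id (0 : ℂ)).neg).const_cpow (Or.inl two_ne_zero)
  have h := (hasDerivAt_quadrantZeta_zero.sub (h1.mul hasDerivAt_riemannZeta_two_mul)).div_const 2
  refine h.congr_deriv ?_
  simp [riemannZeta_zero]
  ring

/-- The only possible poles are `s = 1/2`, where `2s = 1` and `2s - 1 = 0`, and `s = 1`, where `2s -
1 = 1`. -/
lemma differentiableAt_octantZeta {s : ℂ} (h1 : s ≠ 1) (h2 : s ≠ 1 / 2) :
    DifferentiableAt ℂ octantZeta s := by
  have hp : (π : ℂ) ≠ 0 := ofReal_ne_zero.2 Real.pi_ne_zero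
  have hz : DifferentiableAt ℂ (fun s : ℂ => riemannZeta (2 * s)) s :=
    (differentiableAt_riemannZeta fun h => h2 (by linear_combination h / 2)).comp s
      (differentiableAt_id.const_mul 2)
  have hc : DifferentiableAt ℂ (fun s : ℂ => completedRiemannZeta (2 * s - 1)) s :=
    (differentiableAt_completedZeta (fun h => h2 (by linear_combination h / 2))
      (fun h => h1 (by linear_combination h / 2))).comp s
      ((differentiableAt_id.const_mul 2).sub_const 1)
  have hq : DifferentiableAt ℂ quadrantZeta s :=
    (((differentiableAt_id.const_cpow (Or.inl hp)).mul (differentiable_one_div_Gamma s)).mul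
      ((differentiable_crossMellin s).add (hc.div_const 2))).sub (hz.div_const 2)
  exact (hq.sub ((differentiableAt_id.neg.const_cpow (Or.inl two_ne_zero)).mul hz)).div_const 2

lemma analyticAt_octantZeta {s : ℂ} (h1 : s ≠ 1) (h2 : s ≠ 1 / 2) :
    AnalyticAt ℂ octantZeta s := by
  refine DifferentiableOn.analyticAt (s := ({1, 1 / 2} : Set ℂ)ᶜ) (fun z hz => ?_)
    ((Set.toFinite _).isClosed.isOpen_compl.mem_nhds (by simpa [h1] using h2))
  simp only [mem_compl_iff, mem_insert_iff, mem_singleton_iff, not_or] at hz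
  exact (differentiableAt_octantZeta hz.1 hz.2).differentiableWithinAt

lemma meromorphicAt_riemannZeta (s : ℂ) : MeromorphicAt riemannZeta s := by
  have h : MeromorphicAt (fun s : ℂ => (s - 1)⁻¹ + riemannZeta₀ s) s :=
    ((by fun_prop : AnalyticAt ℂ (fun s : ℂ => s - 1) s).meromorphicAt.fun_inv).fun_add
      (differentiable_riemannZeta₀.analyticAt s).meromorphicAt
  refine h.congr ?_
  have : ∀ᶠ z in 𝓝[≠] s, z ≠ 1 := by
    rcases eq_or_ne s 1 with rfl | hs
    · exact self_mem_nhdsWithin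
    · exact Filter.Eventually.filter_mono nhdsWithin_le_nhds (isOpen_ne.mem_nhds hs)
  filter_upwards [this] with z hz using (riemannZeta_eq_inv_sub_add hz).symm

lemma meromorphicAt_completedRiemannZeta (s : ℂ) : MeromorphicAt completedRiemannZeta s := by
  have h : MeromorphicAt (fun s : ℂ => completedRiemannZeta₀ s - 1 / s - 1 / (1 - s)) s :=
    ((differentiable_completedZeta₀.analyticAt s).meromorphicAt.fun_sub
      (MeromorphicAt.fun_div (MeromorphicAt.const 1 s) (MeromorphicAt.id s))).fun_sub
      (MeromorphicAt.fun_div (MeromorphicAt.const 1 s)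
        (by fun_prop : AnalyticAt ℂ (fun s : ℂ => 1 - s) s).meromorphicAt)
  exact h.congr (Eventually.of_forall fun z => (completedRiemannZeta_eq z).symm)

lemma meromorphicAt_octantZeta (s : ℂ) : MeromorphicAt octantZeta s := by
  have hp : (π : ℂ) ≠ 0 := ofReal_ne_zero.2 Real.pi_ne_zero
  have hz : MeromorphicAt (fun s : ℂ => riemannZeta (2 * s)) s :=
    (meromorphicAt_riemannZeta (2 * s)).comp_analyticAt (g := fun s : ℂ => 2 * s) (by fun_prop)
  have hc : MeromorphicAt (fun s : ℂ => completedRiemannZeta (2 * s - 1)) s :=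
    (meromorphicAt_completedRiemannZeta (2 * s - 1)).comp_analyticAt
      (g := fun s : ℂ => 2 * s - 1) (by fun_prop)
  have ha : ∀ {f : ℂ → ℂ}, Differentiable ℂ f → MeromorphicAt f s := fun h =>
    (h.analyticAt s).meromorphicAt
  have hq : MeromorphicAt quadrantZeta s :=
    (((ha (differentiable_id.const_cpow (Or.inl hp))).mul (ha differentiable_one_div_Gamma)).mul
      ((ha differentiable_crossMellin).add (hc.fun_div (MeromorphicAt.const 2 s)))).sub
      (hz.fun_div (MeromorphicAt.const 2 s))
  exact (hq.sub ((ha (differentiable_id.neg.const_cpow (Or.inl two_ne_zero))).mul hz)).div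
    (MeromorphicAt.const 2 s)

/-- Identity theorem for meromorphic functions in normal form that agree on a half plane. -/
lemma eq_of_meromorphicNFOn {Z W : ℂ → ℂ} (hZ : MeromorphicNFOn Z univ)
    (hW : MeromorphicNFOn W univ) (h : ∀ s : ℂ, 1 < s.re → Z s = W s) : Z = W := by
  have hd : MeromorphicOn (Z - W) univ := fun s hs =>
    (hZ hs).meromorphicAt.sub (hW hs).meromorphicAt
  have h2 : meromorphicOrderAt (Z - W) 2 = ⊤ := by
    rw [meromorphicOrderAt_eq_top_iff]
    refine Filter.Eventually.filter_mono nhdsWithin_le_nhds ?_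
    filter_upwards [(isOpen_lt continuous_const continuous_re).mem_nhds
      (show (1 : ℝ) < (2 : ℂ).re by norm_num)] with s hs
    simp [h s hs]
  -- Infinite order of vanishing at one point spreads over the connected plane.
  have hall : ∀ s : ℂ, meromorphicOrderAt (Z - W) s = ⊤ := fun s => by
    by_contra hs
    exact hd.meromorphicOrderAt_ne_top_of_isPreconnected isPreconnected_univ (mem_univ s)
      (mem_univ 2) hs h2
  funext s
  have hs := meromorphicOrderAt_eq_top_iff.1 (hall s)
  -- This is agreement on a punctured neighbourhood; the normal form extends it to the point itself,
  -- poles included.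
  have he : Z =ᶠ[𝓝[≠] s] W := hs.mono fun z hz => sub_eq_zero.1 hz
  exact (((hZ (mem_univ s)).eventuallyEq_nhdsNE_iff_eventuallyEq_nhds (hW (mem_univ s))).1
    he).eq_of_nhds

end SpecialValues

end DirichletLaplacian

namespace DirichletLaplacian

open scoped Real
open Set

/-! ### The Lambert series as a divisor sum and as the logarithm of an eta product. -/

section Series

open Complex

/-- Pairs are grouped by their product: if `xy = n` then `1/y = x/n`, so the fibre over `n`
contributes `e^(-2πn) / n` times the sum of the divisors of `n`. -/
lemma hasSum_lambert_divisors :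
    HasSum (fun n : ℕ+ => 1 / ((n : ℝ) * Real.exp (2 * π * n)) * ∑ d ∈ (n : ℕ).divisors, (d : ℝ))
      (∑' p : ℕ+ × ℕ+, Real.exp (-2 * π * (p.1 * p.2)) / (p.2 : ℝ)) := by
  have h := summable_lambert.hasSum
  rw [← sigmaAntidiagonalEquivProd.hasSum_iff] at h
  refine (h.sigma fun n => hasSum_fintype _).congr_fun fun n => ?_
  have hn : (n : ℝ) ≠ 0 := by positivity
  have e : ∀ x : (n : ℕ).divisorsAntidiagonal,
      (((fun p : ℕ+ × ℕ+ => Real.exp (-2 * π * (p.1 * p.2)) / (p.2 : ℝ)) ∘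
        sigmaAntidiagonalEquivProd) ⟨n, x⟩) =
      1 / ((n : ℝ) * Real.exp (2 * π * n)) * (x.1.1 : ℝ) := by
    rintro ⟨⟨x, y⟩, hxy⟩
    obtain ⟨h1, h2⟩ := Nat.mem_divisorsAntidiagonal.1 hxy
    simp only [] at h1
    have hy : (y : ℝ) ≠ 0 := by
      have : y ≠ 0 := by rintro rfl; simp at h1; exact h2 h1.symm
      exact_mod_cast this
    have hc : (n : ℝ) = x * y := by exact_mod_cast h1.symm
    simp only [Function.comp, sigmaAntidiagonalEquivProd, divisorsAntidiagonalFactors,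
      Equiv.coe_fn_mk, PNat.mk_coe]
    rw [← hc, show -2 * π * (n : ℝ) = -(2 * π * n) by ring, Real.exp_neg]
    have hx : (x : ℝ) = n / y := by rw [hc]; field_simp
    rw [hx]
    field_simp
  rw [Finset.sum_congr rfl fun x _ => e x, ← Finset.mul_sum, Finset.univ_eq_attach,
    Finset.sum_attach _ fun x : ℕ × ℕ => (x.1 : ℝ),
    Nat.sum_divisorsAntidiagonal (fun x _ => (x : ℝ))]

lemma exp_neg_two_pi_mul_lt_one (m : ℕ+) : Real.exp (-2 * π * m) < 1 := by
  rw [Real.exp_lt_one_iff]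
  have : (0 : ℝ) < 2 * π * m := by positivity
  linarith

/-- Summing over the second index first gives the Taylor series of `-log(1 - e^(-2πm))`. -/
lemma hasSum_lambert_log :
    HasSum (fun m : ℕ+ => Real.log (1 - Real.exp (-2 * π * m)))
      (-∑' p : ℕ+ × ℕ+, Real.exp (-2 * π * (p.1 * p.2)) / (p.2 : ℝ)) := by
  refine (HasSum.prod_fiberwise summable_lambert.hasSum
    (g := fun m : ℕ+ => -Real.log (1 - Real.exp (-2 * π * m))) fun m => ?_).neg.congr_fun
    fun m => (neg_neg _).symm
  have h := Real.hasSum_pow_div_log_of_abs_lt_one (x := Real.exp (-2 * π * m))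
    (by rw [abs_of_pos (Real.exp_pos _)]; exact exp_neg_two_pi_mul_lt_one m)
  rw [← Equiv.pnatEquivNat.symm.hasSum_iff]
  refine h.congr_fun fun k => ?_
  rw [← Real.exp_nat_mul]
  simp only [Function.comp, Equiv.pnatEquivNat_symm_apply, Nat.succPNat_coe]
  push_cast
  congr 2
  ring

/-- At `τ = i` the nome is `e^(-2π)`: all factors of the product are real and positive, and the
factor `e^(πiτ/12)` has norm `e^(-π/12)`. -/
lemma log_norm_eta_I :
    Real.log ‖ModularForm.eta I‖ =
      -(π / 12) - ∑' p : ℕ+ × ℕ+, Real.exp (-2 * π * (p.1 * p.2)) / (p.2 : ℝ) := by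
  have hI : (I : ℂ) ∈ UpperHalfPlane.upperHalfPlaneSet := by simp [UpperHalfPlane.upperHalfPlaneSet]
  have hq : ∀ n : ℕ, 1 - ModularForm.eta_q n I = ((1 - Real.exp (-2 * π * (n + 1)) : ℝ) : ℂ) := by
    intro n
    rw [ModularForm.eta_q_eq_cexp]
    push_cast
    congr 2
    linear_combination (2 * π * (n + 1) : ℂ) * I_mul_I
  have hpos : ∀ n : ℕ, 0 < 1 - Real.exp (-2 * π * (n + 1)) := fun n => by
    have := exp_neg_two_pi_mul_lt_one n.succPNat
    simp only [Nat.succPNat_coe, Nat.cast_succ] at this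
    linarith
  have hlog : HasSum (fun n : ℕ => Real.log (1 - Real.exp (-2 * π * (n + 1))))
      (-∑' p : ℕ+ × ℕ+, Real.exp (-2 * π * (p.1 * p.2)) / (p.2 : ℝ)) := by
    have h := hasSum_lambert_log
    rw [← Equiv.pnatEquivNat.symm.hasSum_iff] at h
    refine h.congr_fun fun n => ?_
    simp
  have hprod : ∏' n, (1 - ModularForm.eta_q n I) =
      ((Real.exp (-∑' p : ℕ+ × ℕ+, Real.exp (-2 * π * (p.1 * p.2)) / (p.2 : ℝ)) : ℝ) : ℂ) := by
    rw [← hlog.tsum_eq, Real.rexp_tsum_eq_tprod hpos hlog.summable]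
    have hm : Multipliable fun n : ℕ => 1 - Real.exp (-2 * π * (n + 1)) :=
      Real.multipliable_of_summable_log hpos hlog.summable
    rw [tprod_congr hq]
    exact (hm.map_tprod Complex.ofRealHom continuous_ofReal).symm
  have hn : ‖Function.Periodic.qParam 24 I‖ = Real.exp (-(π / 12)) := by
    rw [Function.Periodic.norm_qParam]
    simp
    ring
  rw [ModularForm.eta, norm_mul, hn, hprod, Complex.norm_real, Real.norm_of_nonneg (Real.exp_pos _).le,
    ← Real.exp_add, Real.log_exp, sub_eq_add_neg]

end Series

end DirichletLaplacian

namespace DirichletLaplacian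

open scoped Real
open Set

/-! ### From the eigenvalue count to the spectral zeta function. -/

section SpectralZeta

open Complex

/-- The pairs `m > n ≥ 1`, which label the eigenfunctions of the right isosceles triangle. -/
abbrev Octant : Type := {p : ℕ+ × ℕ+ // p.2 < p.1}

/-- The eigenvalue `(π / a)² (m² + n²)`. -/
noncomputable def eigval (a : ℝ) (p : Octant) : ℝ :=
  (π / a) ^ 2 * ((p.1.1 : ℝ) ^ 2 + (p.1.2 : ℝ) ^ 2)

lemma eigval_pos {a : ℝ} (ha : 0 < a) (p : Octant) : 0 < eigval a p := by
  unfold eigval; positivity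

/-- A bound on `m² + n²` bounds both `m` and `n`, so a fibre embeds in a finite square. -/
lemma finite_eigval_fiber {a : ℝ} (ha : 0 < a) (μ : ℝ) : Finite {p : Octant // eigval a p = μ} := by
  obtain ⟨N, hN⟩ := exists_nat_gt (μ / (π / a) ^ 2)
  have hb : ∀ p : Octant, eigval a p = μ → (p.1.1 : ℕ) < N ∧ (p.1.2 : ℕ) < N := by
    intro p hp
    have h1 : (1 : ℝ) ≤ p.1.1 := by exact_mod_cast p.1.1.2
    have h2 : (1 : ℝ) ≤ p.1.2 := by exact_mod_cast p.1.2.2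
    have h3 : (p.1.1 : ℝ) ^ 2 + (p.1.2 : ℝ) ^ 2 < N := by
      refine lt_of_eq_of_lt ?_ hN
      rw [← hp, eigval]; field_simp
    constructor
    · have : (p.1.1 : ℝ) < N := by nlinarith
      exact_mod_cast this
    · have : (p.1.2 : ℝ) < N := by nlinarith
      exact_mod_cast this
  refine Finite.of_injective
    (fun p : {p : Octant // eigval a p = μ} =>
      ((⟨_, (hb p.1 p.2).1⟩, ⟨_, (hb p.1 p.2).2⟩) : Fin N × Fin N)) ?_
  rintro ⟨⟨⟨m, n⟩, h⟩, hp⟩ ⟨⟨⟨m', n'⟩, h'⟩, hp'⟩ he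
  simp only [Prod.mk.injEq, Fin.mk.injEq, PNat.coe_inj] at he
  obtain ⟨rfl, rfl⟩ := he
  rfl

/-- The continuation of the spectral zeta function of the triangle with legs `a`. -/
noncomputable def triangleZeta (a : ℝ) (s : ℂ) : ℂ := ((a / π : ℝ) : ℂ) ^ (2 * s) * octantZeta s

lemma hasSum_triangleZeta {a : ℝ} (ha : 0 < a) {s : ℂ} (hs : 1 < s.re) :
    HasSum (fun p : Octant => ((eigval a p : ℝ) : ℂ) ^ (-s)) (triangleZeta a s) := by
  refine ((hasSum_octantZeta hs).mul_left (((a / π : ℝ) : ℂ) ^ (2 * s))).congr_fun fun p => ?_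
  have h0 : (0 : ℝ) ≤ π / a := by positivity
  have h1 : (0 : ℝ) ≤ (π / a) ^ 2 := by positivity
  rw [eigval, ofReal_mul, mul_cpow_ofReal_nonneg h1 (by positivity), one_div, ← cpow_neg]
  congr 1
  rw [pow_two, ofReal_mul, mul_cpow_ofReal_nonneg h0 h0, ← cpow_add _ _ (by
    rw [ofReal_ne_zero]; positivity), ← inv_div, ofReal_inv, inv_cpow, ← cpow_neg]
  · congr 1; ring
  · rw [arg_ofReal_of_nonneg (by positivity)]; exact Real.pi_pos.ne

lemma differentiable_scale {a : ℝ} (ha : 0 < a) :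
    Differentiable ℂ fun s : ℂ => ((a / π : ℝ) : ℂ) ^ (2 * s) :=
  (differentiable_id.const_mul 2).const_cpow (Or.inl (by rw [ofReal_ne_zero]; positivity))

lemma meromorphicOn_triangleZeta {a : ℝ} (ha : 0 < a) : MeromorphicOn (triangleZeta a) univ :=
  fun s _ => ((differentiable_scale ha).analyticAt s).meromorphicAt.mul (meromorphicAt_octantZeta s)

lemma analyticAt_triangleZeta {a : ℝ} (ha : 0 < a) {s : ℂ} (h1 : s ≠ 1) (h2 : s ≠ 1 / 2) :
    AnalyticAt ℂ (triangleZeta a) s :=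
  ((differentiable_scale ha).analyticAt s).mul (analyticAt_octantZeta h1 h2)

/-- The scaling factor contributes `2 log(a/π) · 3/8`. Together with `(3/4) log(2π) - (1/4) log 2`
from the octant sum, all occurrences of `log π` cancel and `(1/4) log(4a³)` is left. -/
lemma deriv_triangleZeta_zero {a : ℝ} (ha : 0 < a) :
    deriv (triangleZeta a) 0 = ((Real.log (4 * a ^ 3) / 4 + π / 24 +
      1 / 2 * ∑' p : ℕ+ × ℕ+, Real.exp (-2 * π * (p.1 * p.2)) / (p.2 : ℝ) : ℝ) : ℂ) := by
  have hb : ((a / π : ℝ) : ℂ) ≠ 0 := by rw [ofReal_ne_zero]; positivity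
  have h1 : HasDerivAt (fun s : ℂ => ((a / π : ℝ) : ℂ) ^ (2 * s))
      (((a / π : ℝ) : ℂ) ^ (2 * 0 : ℂ) * log ((a / π : ℝ) : ℂ) * (2 * 1)) 0 :=
    ((hasDerivAt_id (0 : ℂ)).const_mul 2).const_cpow (Or.inl hb)
  have h := (h1.mul hasDerivAt_octantZeta_zero).deriv
  have e : (fun s : ℂ => ((a / π : ℝ) : ℂ) ^ (2 * s)) * octantZeta = triangleZeta a := rfl
  rw [e] at h
  rw [h, octantZeta_zero, crossMellin_zero, ← ofReal_log (by positivity),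
    show (2 * π : ℂ) = ((2 * π : ℝ) : ℂ) by push_cast; rfl, ← ofReal_log (by positivity),
    show (2 : ℂ) = ((2 : ℝ) : ℂ) by push_cast; rfl, ← ofReal_log (by positivity)]
  have l1 : Real.log (4 * a ^ 3) = 2 * Real.log 2 + 3 * Real.log a := by
    rw [Real.log_mul (by norm_num) (by positivity), show (4 : ℝ) = 2 ^ 2 by norm_num, Real.log_pow,
      Real.log_pow]
    push_cast; ring
  have l2 : Real.log (a / π) = Real.log a - Real.log π := Real.log_div ha.ne' Real.pi_ne_zero
  have l3 : Real.log (2 * π) = Real.log 2 + Real.log π :=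
    Real.log_mul two_ne_zero Real.pi_ne_zero
  rw [l1, l2, l3]
  simp only [ofReal_ofNat, mul_zero, cpow_zero]
  push_cast
  ring

variable {Ω : Opens Plane} {a : ℝ}

lemma mem_spectrum_iff [∀ μ, FiniteDimensional ℝ (eigenspace Ω μ)]
    (ha : 0 < a) (hm : ∀ μ, multiplicity Ω μ = Nat.card {p : Octant // eigval a p = μ}) (μ : ℝ) :
    μ ∈ spectrum Ω ↔ ∃ p, eigval a p = μ := by
  have := finite_eigval_fiber ha μ
  -- Finite dimension matters here: `finrank` is also `0` on infinite-dimensional spaces. Likewise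
  -- `Nat.card` detects emptiness only because the fibre is finite.
  rw [spectrum, mem_ofPred_eq, Ne, ← Submodule.finrank_eq_zero (R := ℝ)]
  change multiplicity Ω μ ≠ 0 ↔ _
  rw [hm, Nat.card_ne_zero]
  simp [this]

/-- The sum over pairs is regrouped along the fibres of the eigenvalue map; each fibre is constant
with as many terms as the multiplicity. -/
lemma hasSum_spectrum [∀ μ, FiniteDimensional ℝ (eigenspace Ω μ)]
    (ha : 0 < a) (hm : ∀ μ, multiplicity Ω μ = Nat.card {p : Octant // eigval a p = μ})
    {s : ℂ} (hs : 1 < s.re) :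
    HasSum (fun μ : spectrum Ω => (multiplicity Ω μ : ℂ) * ((μ : ℝ) : ℂ) ^ (-s))
      (triangleZeta a s) := by
  let g : Octant → spectrum Ω := fun p =>
    ⟨eigval a p, (mem_spectrum_iff ha hm _).2 ⟨p, rfl⟩⟩
  have h := hasSum_triangleZeta ha hs
  rw [← (Equiv.sigmaFiberEquiv g).hasSum_iff] at h
  refine HasSum.sigma (h : HasSum (fun x : Σ μ, {p // g p = μ} => _) _) fun μ => ?_
  have he : {p : Octant // g p = μ} ≃ {p : Octant // eigval a p = (μ : ℝ)} :=
    Equiv.subtypeEquivRight fun p => Subtype.ext_iff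
  have := finite_eigval_fiber ha μ
  have : Finite {p : Octant // g p = μ} := Finite.of_equiv _ he.symm
  have : Fintype {p : Octant // g p = μ} := Fintype.ofFinite _
  rw [hm, ← Nat.card_congr he, Nat.card_eq_fintype_card, ← nsmul_eq_mul]
  have hc : ∀ x : {p : Octant // g p = μ}, ((fun p : Octant => ((eigval a p : ℝ) : ℂ) ^ (-s)) ∘
      Equiv.sigmaFiberEquiv g) ⟨μ, x⟩ = ((μ : ℝ) : ℂ) ^ (-s) := by
    rintro ⟨p, hp⟩
    simp only [Function.comp, Equiv.sigmaFiberEquiv_apply, ← hp, g]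
  have hs := hasSum_fintype fun x : {p : Octant // g p = μ} =>
    ((fun p : Octant => ((eigval a p : ℝ) : ℂ) ^ (-s)) ∘ Equiv.sigmaFiberEquiv g) ⟨μ, x⟩
  rw [Finset.sum_congr rfl fun x _ => hc x, Finset.sum_const, Finset.card_univ] at hs
  exact hs

/-- Passing to normal form can change values only at `1/2` and `1`, so the sum for `Re s > 1` is
unaffected. -/
lemma isSpectralZeta_toMeromorphicNFOn [∀ μ, FiniteDimensional ℝ (eigenspace Ω μ)]
    (ha : 0 < a) (hm : ∀ μ, multiplicity Ω μ = Nat.card {p : Octant // eigval a p = μ}) :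
    IsSpectralZeta Ω (toMeromorphicNFOn (triangleZeta a) univ) where
  hasSum s hs := by
    have h1 : s ≠ 1 := by rintro rfl; simp at hs
    have h2 : s ≠ 1 / 2 := by rintro rfl; norm_num at hs
    rw [toMeromorphicNFOn_eq_toMeromorphicNFAt (meromorphicOn_triangleZeta ha) (mem_univ s),
      toMeromorphicNFAt_eq_self.2 (analyticAt_triangleZeta ha h1 h2).meromorphicNFAt]
    exact hasSum_spectrum ha hm hs
  meromorphic := meromorphicNFOn_toMeromorphicNFOn _ _

lemma IsSpectralZeta.unique {Z W : ℂ → ℂ} (hZ : IsSpectralZeta Ω Z) (hW : IsSpectralZeta Ω W) :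
    Z = W :=
  eq_of_meromorphicNFOn hZ.meromorphic hW.meromorphic fun s hs =>
    (hZ.hasSum s hs).unique (hW.hasSum s hs)

/-- The function chosen in `spectralZeta` is pinned down by uniqueness. -/
lemma spectralZeta_eventuallyEq [∀ μ, FiniteDimensional ℝ (eigenspace Ω μ)]
    (ha : 0 < a) (hm : ∀ μ, multiplicity Ω μ = Nat.card {p : Octant // eigval a p = μ}) :
    spectralZeta Ω =ᶠ[𝓝 0] triangleZeta a := by
  have hex : ∃ Z, IsSpectralZeta Ω Z := ⟨_, isSpectralZeta_toMeromorphicNFOn ha hm⟩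
  have hZ : spectralZeta Ω = toMeromorphicNFOn (triangleZeta a) univ := by
    rw [spectralZeta, dif_pos hex]
    exact hex.choose_spec.unique (isSpectralZeta_toMeromorphicNFOn ha hm)
  rw [hZ]
  -- The half plane `Re s < 1/4` contains `0` and avoids both exceptional points.
  filter_upwards [(isOpen_lt continuous_re continuous_const).mem_nhds
    (show (0 : ℂ).re < (1 / 4 : ℝ) by norm_num)] with s (hs : s.re < 1 / 4)
  have h1 : s ≠ 1 := by rintro rfl; norm_num at hs
  have h2 : s ≠ 1 / 2 := by rintro rfl; norm_num at hs
  rw [toMeromorphicNFOn_eq_toMeromorphicNFAt (meromorphicOn_triangleZeta ha) (mem_univ s),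
    toMeromorphicNFAt_eq_self.2 (analyticAt_triangleZeta ha h1 h2).meromorphicNFAt]

end SpectralZeta

end DirichletLaplacian

namespace DirichletLaplacian

open Set

/-! ### Weak derivatives and integration by parts on bounded domains. -/

section BoundedDomain

variable {Ω : Opens Plane}

lemma isFiniteMeasure_restrict (hb : Bornology.IsBounded (Ω : Set Plane)) :
    IsFiniteMeasure (volume.restrict (Ω : Set Plane)) :=
  ⟨by rw [Measure.restrict_apply_univ]; exact hb.measure_lt_top⟩

lemma memLp_of_continuous (hb : Bornology.IsBounded (Ω : Set Plane)) {f : Plane → ℝ}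
    (hf : Continuous f) : MemLp f 2 (volume.restrict (Ω : Set Plane)) := by
  have := isFiniteMeasure_restrict hb
  obtain ⟨C, hC⟩ := hb.isCompact_closure.exists_bound_of_continuousOn hf.continuousOn
  refine MemLp.of_bound hf.aestronglyMeasurable C ?_
  filter_upwards [ae_restrict_mem Ω.isOpen.measurableSet] with x hx using hC x (subset_closure hx)

/-- The class in `L²(Ω)` of a continuous function, for bounded `Ω`. -/
noncomputable def toL2 (hb : Bornology.IsBounded (Ω : Set Plane)) {f : Plane → ℝ}
    (hf : Continuous f) : L2 Ω := (memLp_of_continuous hb hf).toLp f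

lemma coeFn_toL2 (hb : Bornology.IsBounded (Ω : Set Plane)) {f : Plane → ℝ}
    (hf : Continuous f) : toL2 hb hf =ᵐ[volume.restrict (Ω : Set Plane)] f :=
  MemLp.coeFn_toLp _

/-- Dominated convergence: constants are square integrable because `Ω` has finite measure. -/
lemma tendsto_eLpNorm_two_of_bounded (hb : Bornology.IsBounded (Ω : Set Plane))
    {f : ℕ → Plane → ℝ} (hf : ∀ k, Continuous (f k)) {M : ℝ}
    (hM : ∀ k, ∀ x ∈ Ω, |f k x| ≤ M) (h : ∀ x ∈ Ω, Tendsto (fun k => f k x) atTop (𝓝 0)) :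
    Tendsto (fun k => eLpNorm (f k) 2 (volume.restrict (Ω : Set Plane))) atTop (𝓝 0) := by
  have := isFiniteMeasure_restrict hb
  have hl : Tendsto (fun k => ∫⁻ x in (Ω : Set Plane), ‖f k x‖ₑ ^ (2 : ℝ)) atTop
      (𝓝 (∫⁻ _ in (Ω : Set Plane), 0)) := by
    refine tendsto_lintegral_of_dominated_convergence (fun _ => ENNReal.ofReal M ^ (2 : ℝ))
      (fun k => ((hf k).measurable.enorm.pow_const _)) (fun k => ?_) ?_ ?_
    · filter_upwards [ae_restrict_mem Ω.isOpen.measurableSet] with x hx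
      refine ENNReal.rpow_le_rpow ?_ (by norm_num)
      rw [← ofReal_norm]
      exact ENNReal.ofReal_le_ofReal (hM k x hx)
    · rw [lintegral_const]
      exact ENNReal.mul_ne_top (ENNReal.rpow_ne_top_of_nonneg (by norm_num) ENNReal.ofReal_ne_top)
        (measure_ne_top _ _)
    · filter_upwards [ae_restrict_mem Ω.isOpen.measurableSet] with x hx
      have h1 : Tendsto (fun k => ‖f k x‖ₑ) atTop (𝓝 0) := by
        simpa using (h x hx).enorm
      have h2 := (ENNReal.continuous_rpow_const (y := (2 : ℝ))).tendsto 0 |>.comp h1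
      simpa [Function.comp_def] using h2
  rw [lintegral_zero] at hl
  have h3 := (ENNReal.continuous_rpow_const (y := (1 / 2 : ℝ))).tendsto 0 |>.comp hl
  rw [ENNReal.zero_rpow_of_pos (by norm_num)] at h3
  refine h3.congr fun k => ?_
  rw [eLpNorm_eq_lintegral_rpow_enorm_toReal two_ne_zero ENNReal.ofNat_ne_top]
  simp

/-- Continuity of the inner product of `L²`, written with integrals. -/
lemma tendsto_integral_mul_of_tendsto_eLpNorm {f : ℕ → Plane → ℝ}
    (hf : ∀ k, MemLp (f k) 2 (volume.restrict (Ω : Set Plane))) {u w : Plane → ℝ}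
    (hu : MemLp u 2 (volume.restrict (Ω : Set Plane)))
    (hw : MemLp w 2 (volume.restrict (Ω : Set Plane)))
    (h : Tendsto (fun k => eLpNorm (fun x => f k x - u x) 2 (volume.restrict (Ω : Set Plane)))
      atTop (𝓝 0)) :
    Tendsto (fun k => ∫ x in (Ω : Set Plane), w x * f k x) atTop
      (𝓝 (∫ x in (Ω : Set Plane), w x * u x)) := by
  have h1 := (Lp.tendsto_Lp_iff_tendsto_eLpNorm'' f hf u hu).2 h
  have h2 := h1.inner (tendsto_const_nhds (x := hw.toLp w)) (𝕜 := ℝ)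
  have key : ∀ {g : Plane → ℝ} (hg : MemLp g 2 (volume.restrict (Ω : Set Plane))),
      inner ℝ (hg.toLp g) (hw.toLp w) = ∫ x in (Ω : Set Plane), w x * g x := by
    intro g hg
    rw [L2.inner_def]
    refine integral_congr_ae ?_
    filter_upwards [hg.coeFn_toLp, hw.coeFn_toLp] with x h1 h2
    rw [h1, h2]
    rfl
  simpa only [key] using h2

lemma memLp_testFunction (φ : 𝓓(Ω, ℝ)) : MemLp φ 2 (volume.restrict (Ω : Set Plane)) :=
  φ.continuous.memLp_of_hasCompactSupport φ.hasCompactSupport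

lemma memLp_fderiv_testFunction (φ : 𝓓(Ω, ℝ)) (v : Plane) :
    MemLp (fun x => fderiv ℝ φ x v) 2 (volume.restrict (Ω : Set Plane)) :=
  (continuous_fderiv_testFunction φ v).memLp_of_hasCompactSupport
    (φ.hasCompactSupport.fderiv_apply ℝ v)

/-- The test function is supported inside `Ω`, so both integrals extend to the whole plane and no
boundary term arises. -/
lemma setIntegral_mul_fderiv_testFunction {f : Plane → ℝ} (hf : ContDiff ℝ ∞ f) (v : Plane)
    (φ : 𝓓(Ω, ℝ)) :
    ∫ x in (Ω : Set Plane), f x * fderiv ℝ φ x v =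
      - ∫ x in (Ω : Set Plane), fderiv ℝ f x v * φ x := by
  have hf' : Continuous fun x => fderiv ℝ f x v :=
    (hf.continuous_fderiv (by simp)).clm_apply continuous_const
  have hz : ∀ x, x ∉ (Ω : Set Plane) → φ x = 0 := fun x hx =>
    image_eq_zero_of_notMem_tsupport fun h => hx (φ.tsupport_subset h)
  have hz' : ∀ x, x ∉ (Ω : Set Plane) → fderiv ℝ φ x v = 0 := fun x hx => by
    have : fderiv ℝ φ x = 0 := by
      by_contra h
      exact hx (φ.tsupport_subset (support_fderiv_subset ℝ h))
    rw [this]; rfl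
  rw [setIntegral_eq_integral_of_forall_compl_eq_zero fun x hx => by rw [hz' x hx, mul_zero],
    setIntegral_eq_integral_of_forall_compl_eq_zero fun x hx => by rw [hz x hx, mul_zero]]
  refine integral_mul_fderiv_eq_neg_fderiv_mul_of_integrable ?_ ?_ ?_
    (fun x _ => hf.differentiable (by simp) x) (fun x _ => differentiable_testFunction φ x)
  · exact (hf'.mul φ.continuous).integrable_of_hasCompactSupport φ.hasCompactSupport.mul_left
  · exact (hf.continuous.mul (continuous_fderiv_testFunction φ v)).integrable_of_hasCompactSupport
      (φ.hasCompactSupport.fderiv_apply ℝ v).mul_left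
  · exact (hf.continuous.mul φ.continuous).integrable_of_hasCompactSupport
      φ.hasCompactSupport.mul_left

lemma contDiff_fderiv_apply {f : Plane → ℝ} (hf : ContDiff ℝ ∞ f) (v : Plane) :
    ContDiff ℝ ∞ fun x => fderiv ℝ f x v :=
  (hf.fderiv_right (m := ∞) (by simp)).clm_apply contDiff_const

lemma hasWeakDeriv_toL2 (hb : Bornology.IsBounded (Ω : Set Plane)) {f : Plane → ℝ}
    (hf : ContDiff ℝ ∞ f) (v : Plane) :
    HasWeakDeriv v (toL2 hb hf.continuous) (toL2 hb (contDiff_fderiv_apply hf v).continuous) := by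
  intro φ
  have e1 : ∫ x in (Ω : Set Plane), toL2 hb hf.continuous x * fderiv ℝ φ x v =
      ∫ x in (Ω : Set Plane), f x * fderiv ℝ φ x v := integral_congr_ae <| by
    filter_upwards [coeFn_toL2 hb hf.continuous] with x hx
    rw [hx]
  have e2 : ∫ x in (Ω : Set Plane), toL2 hb (contDiff_fderiv_apply hf v).continuous x * φ x =
      ∫ x in (Ω : Set Plane), fderiv ℝ f x v * φ x := integral_congr_ae <| by
    filter_upwards [coeFn_toL2 hb (contDiff_fderiv_apply hf v).continuous] with x hx
    rw [hx]
  rw [e1, e2, setIntegral_mul_fderiv_testFunction hf]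

lemma memH_toL2 (hb : Bornology.IsBounded (Ω : Set Plane)) :
    ∀ (k : ℕ) {f : Plane → ℝ} (hf : ContDiff ℝ ∞ f), MemH k (toL2 hb hf.continuous)
  | 0, _, _ => trivial
  | k + 1, _, hf => fun v =>
    ⟨_, hasWeakDeriv_toL2 hb hf v, memH_toL2 hb k (contDiff_fderiv_apply hf v)⟩

/-- The Laplacian of a function on the plane. -/
noncomputable def laplacian (f : Plane → ℝ) (x : Plane) : ℝ :=
  ∑ i : Fin 2, fderiv ℝ (fun y => fderiv ℝ f y (EuclideanSpace.single i 1)) x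
    (EuclideanSpace.single i 1)

lemma continuous_laplacian {f : Plane → ℝ} (hf : ContDiff ℝ ∞ f) : Continuous (laplacian f) :=
  continuous_finsetSum _ fun _ _ =>
    (contDiff_fderiv_apply (contDiff_fderiv_apply hf _) _).continuous

lemma hasWeakLaplacian_toL2 (hb : Bornology.IsBounded (Ω : Set Plane)) {f : Plane → ℝ}
    (hf : ContDiff ℝ ∞ f) :
    HasWeakLaplacian (toL2 hb hf.continuous) (toL2 hb (continuous_laplacian hf)) := by
  refine ⟨fun i => toL2 hb (contDiff_fderiv_apply hf (EuclideanSpace.single i 1)).continuous,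
    fun i => toL2 hb (contDiff_fderiv_apply (contDiff_fderiv_apply hf
      (EuclideanSpace.single i 1)) (EuclideanSpace.single i 1)).continuous,
    fun i => ⟨hasWeakDeriv_toL2 hb hf _, hasWeakDeriv_toL2 hb (contDiff_fderiv_apply hf _) _⟩, ?_⟩
  refine Lp.ext ?_
  rw [Fin.sum_univ_two]
  refine EventuallyEq.trans ?_ (Lp.coeFn_add _ _).symm
  filter_upwards [coeFn_toL2 hb (continuous_laplacian hf),
    coeFn_toL2 hb (contDiff_fderiv_apply (contDiff_fderiv_apply hf
      (EuclideanSpace.single 0 1)) (EuclideanSpace.single 0 1)).continuous,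
    coeFn_toL2 hb (contDiff_fderiv_apply (contDiff_fderiv_apply hf
      (EuclideanSpace.single 1 1)) (EuclideanSpace.single 1 1)).continuous] with x h h0 h1
  rw [Pi.add_apply, h, h0, h1, laplacian, Fin.sum_univ_two]

lemma ae_eq_zero_of_integral_testFunction {f : Plane → ℝ}
    (hf : IntegrableOn f (Ω : Set Plane))
    (h : ∀ φ : 𝓓(Ω, ℝ), ∫ x in (Ω : Set Plane), f x * φ x = 0) :
    f =ᵐ[volume.restrict (Ω : Set Plane)] 0 := by
  have h2 := Ω.isOpen.ae_eq_zero_of_integral_contDiff_smul_eq_zero (f := f)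
    (hf.locallyIntegrableOn) fun g hg hc hs => by
      rw [← h ⟨g, hg, hc, hs⟩, ← setIntegral_eq_integral_of_forall_compl_eq_zero (s := (Ω : Set Plane))]
      · refine integral_congr_ae (Eventually.of_forall fun x => ?_)
        exact mul_comm _ _
      · intro x hx
        rw [image_eq_zero_of_notMem_tsupport fun h => hx (hs h), zero_smul]
  exact (ae_restrict_iff' Ω.isOpen.measurableSet).2 h2

/-- The difference is a weak derivative of zero, hence orthogonal to all test functions. -/
lemma HasWeakDeriv.unique (hb : Bornology.IsBounded (Ω : Set Plane)) {v : Plane} {u g g' : L2 Ω}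
    (h : HasWeakDeriv v u g) (h' : HasWeakDeriv v u g') : g = g' := by
  have := isFiniteMeasure_restrict hb
  have hz := (h.add (h'.smul (-1)))
  have hu : u + (-1 : ℝ) • u = 0 := by simp
  rw [hu] at hz
  have h0 : (g + (-1 : ℝ) • g' : L2 Ω) =ᵐ[volume.restrict (Ω : Set Plane)] 0 := by
    refine ae_eq_zero_of_integral_testFunction ((Lp.memLp _).integrable (by norm_num)) fun φ => ?_
    have e := hz φ
    have e1 : ∫ x in (Ω : Set Plane), (0 : L2 Ω) x * fderiv ℝ φ x v = 0 := by
      refine integral_eq_zero_of_ae ?_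
      filter_upwards [Lp.coeFn_zero ℝ 2 (volume.restrict (Ω : Set Plane))] with x hx
      rw [hx]; simp
    rw [e1] at e
    linarith
  have h1 := (Lp.eq_zero_iff_ae_eq_zero).2 h0
  rw [neg_one_smul, ← sub_eq_add_neg, sub_eq_zero] at h1
  exact h1

/-- `u ∈ H¹₀(Ω)` may be integrated by parts against every smooth function on the plane. -/
lemma MemH10.setIntegral_mul_fderiv (hb : Bornology.IsBounded (Ω : Set Plane)) {u g : L2 Ω}
    (hu : MemH10 u) {v : Plane} (hg : HasWeakDeriv v u g) {f : Plane → ℝ} (hf : ContDiff ℝ ∞ f) :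
    ∫ x in (Ω : Set Plane), fderiv ℝ f x v * u x = - ∫ x in (Ω : Set Plane), f x * g x := by
  obtain ⟨φ, hφ, hd⟩ := hu
  obtain ⟨g', hg', ht⟩ := hd v
  -- The derivative approximated in `MemH10` is a priori another one than the given `g`; uniqueness
  -- identifies the two.
  obtain rfl := hg.unique hb hg'
  have h1 := tendsto_integral_mul_of_tendsto_eLpNorm (fun k => memLp_fderiv_testFunction (φ k) v)
    (Lp.memLp g) (memLp_of_continuous hb hf.continuous) ht
  have h2 := tendsto_integral_mul_of_tendsto_eLpNorm (fun k => memLp_testFunction (φ k))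
    (Lp.memLp u) (memLp_of_continuous hb (contDiff_fderiv_apply hf v).continuous) hφ
  have h3 := h2.neg.congr fun k => (setIntegral_mul_fderiv_testFunction hf v (φ k)).symm
  rw [tendsto_nhds_unique h1 h3, neg_neg]

/-- A smooth function that is approximated by test functions in the `H¹`-norm may be integrated by
parts against every `L²` function with a weak derivative. -/
lemma HasWeakDeriv.setIntegral_mul_of_tendsto (hb : Bornology.IsBounded (Ω : Set Plane))
    {u g : L2 Ω} {v : Plane} (hg : HasWeakDeriv v u g) {f : Plane → ℝ} (hf : ContDiff ℝ ∞ f)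
    {φ : ℕ → 𝓓(Ω, ℝ)}
    (hφ : Tendsto (fun k => eLpNorm (fun x => φ k x - f x) 2 (volume.restrict (Ω : Set Plane)))
      atTop (𝓝 0))
    (hd : Tendsto (fun k => eLpNorm (fun x => fderiv ℝ (φ k) x v - fderiv ℝ f x v) 2
      (volume.restrict (Ω : Set Plane))) atTop (𝓝 0)) :
    ∫ x in (Ω : Set Plane), u x * fderiv ℝ f x v = - ∫ x in (Ω : Set Plane), g x * f x := by
  have h1 := tendsto_integral_mul_of_tendsto_eLpNorm (fun k => memLp_fderiv_testFunction (φ k) v)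
    (memLp_of_continuous hb (contDiff_fderiv_apply hf v).continuous) (Lp.memLp u) hd
  have h2 := tendsto_integral_mul_of_tendsto_eLpNorm (fun k => memLp_testFunction (φ k))
    (memLp_of_continuous hb hf.continuous) (Lp.memLp g) hφ
  exact tendsto_nhds_unique h1 (h2.neg.congr fun k => (hg (φ k)).symm)

end BoundedDomain

end DirichletLaplacian

namespace DirichletLaplacian

open Set

/-! ### Approximation by test functions through cutoffs near the sides of a polygon. -/

section Cutoff

/-- A smooth step from `0` on `(-∞, 1]` to `1` on `[2, ∞)`. -/
noncomputable def step (t : ℝ) : ℝ := Real.smoothTransition (t - 1)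

lemma contDiff_step : ContDiff ℝ ∞ step :=
  Real.smoothTransition.contDiff.comp (contDiff_id.sub contDiff_const)

lemma step_nonneg (t : ℝ) : 0 ≤ step t := Real.smoothTransition.nonneg _

lemma step_le_one (t : ℝ) : step t ≤ 1 := Real.smoothTransition.le_one _

lemma abs_step_le_one (t : ℝ) : |step t| ≤ 1 := by
  rw [abs_of_nonneg (step_nonneg t)]; exact step_le_one t

lemma step_of_le_one {t : ℝ} (ht : t ≤ 1) : step t = 0 :=
  Real.smoothTransition.zero_of_nonpos (by linarith)

lemma step_of_two_le {t : ℝ} (ht : 2 ≤ t) : step t = 1 :=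
  Real.smoothTransition.one_of_one_le (by linarith)

lemma deriv_step_of_two_lt {t : ℝ} (ht : 2 < t) : deriv step t = 0 := by
  have h : step =ᶠ[𝓝 t] fun _ => 1 := by
    filter_upwards [Ioi_mem_nhds ht] with s hs using step_of_two_le (le_of_lt hs)
  rw [h.deriv_eq, deriv_const]

lemma deriv_step_of_lt_one {t : ℝ} (ht : t < 1) : deriv step t = 0 := by
  have h : step =ᶠ[𝓝 t] fun _ => 0 := by
    filter_upwards [Iio_mem_nhds ht] with s hs using step_of_le_one (le_of_lt hs)
  rw [h.deriv_eq, deriv_const]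

/-- The derivative of the step lives on `[1, 2]`. This bound compensates the factor `k` that appears
when a cutoff at scale `1/k` is differentiated. -/
lemma exists_abs_mul_deriv_step_le : ∃ C : ℝ, 0 ≤ C ∧ ∀ t : ℝ, |t * deriv step t| ≤ C := by
  have hc : Continuous fun t : ℝ => t * deriv step t :=
    continuous_id.mul (contDiff_step.continuous_deriv (by simp))
  obtain ⟨C, hC⟩ := (isCompact_Icc (a := (1 : ℝ)) (b := 2)).exists_bound_of_continuousOn
    hc.continuousOn
  have h0 : 0 ≤ C := (norm_nonneg _).trans (hC 1 (by norm_num))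
  refine ⟨C, h0, fun t => ?_⟩
  rcases lt_or_ge t 1 with h | h
  · rw [deriv_step_of_lt_one h]; simpa using h0
  rcases lt_or_ge 2 t with h' | h'
  · rw [deriv_step_of_two_lt h']; simpa using h0
  · exact hC t ⟨h, h'⟩

variable {Ω : Opens Plane} {ι : Type*} [Fintype ι]

/-- The cutoff `∏ᵢ step (k ℓᵢ)`, supported in `{ℓᵢ ≥ 1 / k}`. -/
noncomputable def cutoff (ℓ : ι → Plane → ℝ) (k : ℕ) (p : Plane) : ℝ := ∏ i, step (k * ℓ i p)

lemma cutoff_nonneg (ℓ : ι → Plane → ℝ) (k : ℕ) (p : Plane) : 0 ≤ cutoff ℓ k p :=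
  Finset.prod_nonneg fun _ _ => step_nonneg _

lemma cutoff_le_one (ℓ : ι → Plane → ℝ) (k : ℕ) (p : Plane) : cutoff ℓ k p ≤ 1 :=
  Finset.prod_le_one (fun _ _ => step_nonneg _) fun _ _ => step_le_one _

lemma contDiff_cutoff {ℓ : ι → Plane → ℝ} (hℓ : ∀ i, ContDiff ℝ ∞ (ℓ i)) (k : ℕ) :
    ContDiff ℝ ∞ (cutoff ℓ k) :=
  contDiff_prod fun i _ => contDiff_step.comp (contDiff_const.mul (hℓ i))

lemma fderiv_cutoff [DecidableEq ι] {ℓ : ι → Plane → ℝ} {L : ι → Plane →L[ℝ] ℝ}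
    (hL : ∀ i p, HasFDerivAt (ℓ i) (L i) p) (k : ℕ) (p v : Plane) :
    fderiv ℝ (cutoff ℓ k) p v = ∑ i, (∏ j ∈ Finset.univ.erase i, step (k * ℓ j p)) *
      (deriv step (k * ℓ i p) * (k * L i v)) := by
  have h : ∀ i ∈ (Finset.univ : Finset ι), HasFDerivAt (fun q => step (k * ℓ i q))
      (deriv step (k * ℓ i p) • ((k : ℝ) • L i)) p := fun i _ => by
    have h1 : HasDerivAt step (deriv step (k * ℓ i p)) (k * ℓ i p) :=
      (contDiff_step.differentiable (by simp) _).hasDerivAt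
    exact HasDerivAt.comp_hasFDerivAt (h₂ := step) p h1 ((hL i p).const_mul (k : ℝ))
  have h2 := (HasFDerivAt.finsetProd h).fderiv
  have e : fderiv ℝ (cutoff ℓ k) p = fderiv ℝ (fun q => ∏ i, step (k * ℓ i q)) p := rfl
  rw [e, h2]
  simp

lemma eventually_two_lt_mul {ℓ : ι → Plane → ℝ} {p : Plane} (hp : ∀ i, 0 < ℓ i p) :
    ∀ᶠ k : ℕ in atTop, ∀ i, 2 < k * ℓ i p := by
  refine eventually_all.2 fun i => ?_
  exact ((tendsto_natCast_atTop_atTop (R := ℝ)).atTop_mul_const (hp i)).eventually_gt_atTop 2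

/-- The support lies in the closed set where every `k ℓᵢ ≥ 1`, which stays away from the sides. -/
lemma tsupport_mul_cutoff_subset {ℓ : ι → Plane → ℝ} (hℓ : ∀ i, ContDiff ℝ ∞ (ℓ i))
    (hΩ : ∀ p, p ∈ Ω ↔ ∀ i, 0 < ℓ i p) (f : Plane → ℝ) (k : ℕ) :
    tsupport (fun p => f p * cutoff ℓ k p) ⊆ Ω := by
  have hS : IsClosed {p | ∀ i, 1 ≤ k * ℓ i p} := by
    simp only [ofPred_forall]
    exact isClosed_iInter fun i => isClosed_le continuous_const
      (continuous_const.mul (hℓ i).continuous)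
  refine (closure_minimal (t := {p | ∀ i, 1 ≤ k * ℓ i p}) ?_ hS).trans ?_
  · intro p hp i
    by_contra hi
    refine hp ?_
    have : cutoff ℓ k p = 0 := Finset.prod_eq_zero (Finset.mem_univ i)
      (step_of_le_one (le_of_lt (not_le.1 hi)))
    simp only [this, mul_zero]
  · intro p hp
    refine (hΩ p).2 fun i => ?_
    have h1 : (1 : ℝ) ≤ k * ℓ i p := hp i
    by_contra hi
    have : (k : ℝ) * ℓ i p ≤ 0 := mul_nonpos_of_nonneg_of_nonpos (by positivity) (not_lt.1 hi)
    linarith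

/-- A smooth function vanishing to first order on the boundary of a polygon is a limit of test
functions in the `H¹`-norm. -/
lemma exists_testFunction_tendsto [DecidableEq ι] (hb : Bornology.IsBounded (Ω : Set Plane))
    {ℓ : ι → Plane → ℝ} {L : ι → Plane →L[ℝ] ℝ}
    (hℓ : ∀ i, ContDiff ℝ ∞ (ℓ i)) (hL : ∀ i p, HasFDerivAt (ℓ i) (L i) p)
    (hΩ : ∀ p, p ∈ Ω ↔ ∀ i, 0 < ℓ i p) {f : Plane → ℝ} (hf : ContDiff ℝ ∞ f) {C : ℝ}
    (hC : ∀ p ∈ Ω, ∀ i, |f p| ≤ C * |ℓ i p|) :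
    ∃ φ : ℕ → 𝓓(Ω, ℝ),
      Tendsto (fun k => eLpNorm (fun x => φ k x - f x) 2 (volume.restrict (Ω : Set Plane)))
        atTop (𝓝 0) ∧
      ∀ v : Plane, Tendsto (fun k => eLpNorm (fun x => fderiv ℝ (φ k) x v - fderiv ℝ f x v) 2
        (volume.restrict (Ω : Set Plane))) atTop (𝓝 0) := by
  have hs := fun k => tsupport_mul_cutoff_subset hℓ hΩ f k
  have hcd : ∀ k, ContDiff ℝ ∞ fun p => f p * cutoff ℓ k p := fun k =>
    hf.mul (contDiff_cutoff hℓ k)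
  let φ : ℕ → 𝓓(Ω, ℝ) := fun k => ⟨fun p => f p * cutoff ℓ k p, hcd k,
    Metric.isCompact_of_isClosed_isBounded (isClosed_tsupport _) (hb.subset (hs k)), hs k⟩
  have hφ : ∀ k p, φ k p = f p * cutoff ℓ k p := fun _ _ => rfl
  have hφd : ∀ k p v, fderiv ℝ (φ k) p v =
      f p * fderiv ℝ (cutoff ℓ k) p v + cutoff ℓ k p * fderiv ℝ f p v := by
    intro k p v
    have h := ((hf.differentiable (by simp) p).hasFDerivAt.mul
      ((contDiff_cutoff hℓ k).differentiable (by simp) p).hasFDerivAt).fderiv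
    have e : fderiv ℝ (φ k) p = fderiv ℝ (f * cutoff ℓ k) p := rfl
    rw [e, h]
    rfl
  refine ⟨φ, ?_, fun v => ?_⟩
  · obtain ⟨M, hM⟩ := hb.isCompact_closure.exists_bound_of_continuousOn hf.continuous.continuousOn
    refine tendsto_eLpNorm_two_of_bounded hb
      (fun k => (φ k).continuous.sub hf.continuous) (M := M) (fun k x hx => ?_) fun x hx => ?_
    · have h1 := hM x (subset_closure hx)
      rw [Real.norm_eq_abs] at h1
      rw [hφ, show f x * cutoff ℓ k x - f x = f x * (cutoff ℓ k x - 1) by ring, abs_mul]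
      have h2 : |cutoff ℓ k x - 1| ≤ 1 := by
        rw [abs_le]; constructor <;> linarith [cutoff_nonneg ℓ k x, cutoff_le_one ℓ k x]
      nlinarith [abs_nonneg (f x), abs_nonneg (cutoff ℓ k x - 1)]
    · refine tendsto_const_nhds.congr' ?_
      filter_upwards [eventually_two_lt_mul ((hΩ x).1 hx)] with k hk
      rw [hφ, cutoff, Finset.prod_congr rfl fun i _ => step_of_two_le (hk i).le]
      simp
  · obtain ⟨M, hM⟩ := hb.isCompact_closure.exists_bound_of_continuousOn
      (contDiff_fderiv_apply hf v).continuous.continuousOn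
    obtain ⟨D, hD0, hD⟩ := exists_abs_mul_deriv_step_le
    refine tendsto_eLpNorm_two_of_bounded hb
      (fun k => (continuous_fderiv_testFunction (φ k) v).sub (contDiff_fderiv_apply hf v).continuous)
      (M := (∑ i, |C| * D * |L i v|) + M) (fun k x hx => ?_) fun x hx => ?_
    · have h1 := hM x (subset_closure hx)
      rw [Real.norm_eq_abs] at h1
      rw [hφd, show ∀ a b c : ℝ, a + c * b - b = a + b * (c - 1) by intros; ring]
      refine (abs_add_le _ _).trans (add_le_add ?_ ?_)
      -- The first-order vanishing `|f| ≤ C |ℓᵢ|` supplies the factor that turns `k |step'(k ℓᵢ)|`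
      -- into the bounded `|k ℓᵢ step'(k ℓᵢ)|`, uniformly in `k`.
      · rw [fderiv_cutoff hL, Finset.mul_sum]
        refine (Finset.abs_sum_le_sum_abs _ _).trans (Finset.sum_le_sum fun i _ => ?_)
        have hp : |∏ j ∈ Finset.univ.erase i, step (k * ℓ j x)| ≤ 1 := by
          rw [Finset.abs_prod]
          exact Finset.prod_le_one (fun _ _ => abs_nonneg _) fun _ _ => abs_step_le_one _
        have hfi : |f x| ≤ |C| * |ℓ i x| :=
          (hC x hx i).trans (mul_le_mul_of_nonneg_right (le_abs_self C) (abs_nonneg _))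
        have hd := hD (k * ℓ i x)
        rw [abs_mul, abs_mul, Nat.abs_cast] at hd
        rw [abs_mul, abs_mul, abs_mul, abs_mul, Nat.abs_cast]
        calc |f x| * (|∏ j ∈ Finset.univ.erase i, step (k * ℓ j x)| *
              (|deriv step (k * ℓ i x)| * (k * |L i v|)))
            ≤ (|C| * |ℓ i x|) * (1 * (|deriv step (k * ℓ i x)| * (k * |L i v|))) := by gcongr
          _ = |C| * (k * |ℓ i x| * |deriv step (k * ℓ i x)|) * |L i v| := by ring
          _ ≤ |C| * D * |L i v| := by gcongr
      · rw [abs_mul]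
        have h2 : |cutoff ℓ k x - 1| ≤ 1 := by
          rw [abs_le]; constructor <;> linarith [cutoff_nonneg ℓ k x, cutoff_le_one ℓ k x]
        nlinarith [abs_nonneg (fderiv ℝ f x v), abs_nonneg (cutoff ℓ k x - 1)]
    -- At a fixed interior point every `k ℓᵢ` eventually exceeds `2`, so the cutoff is `1` with zero
    -- derivative and the error vanishes.
    · refine tendsto_const_nhds.congr' ?_
      filter_upwards [eventually_two_lt_mul ((hΩ x).1 hx)] with k hk
      rw [hφd, fderiv_cutoff hL, cutoff, Finset.prod_congr rfl fun i _ => step_of_two_le (hk i).le,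
        Finset.sum_eq_zero fun i _ => by rw [deriv_step_of_two_lt (hk i)]; ring]
      simp

end Cutoff

end DirichletLaplacian

namespace DirichletLaplacian

open Set
open scoped Real

/-! ### The antisymmetric sine modes as Dirichlet eigenfunctions. -/

section Modes

/-- The affine coordinate `p ↦ ⟪u, p - O⟫`. -/
noncomputable def coord (O u p : Plane) : ℝ := inner ℝ u (p - O)

lemma hasFDerivAt_coord (O u p : Plane) : HasFDerivAt (coord O u) (innerSL ℝ u) p :=
  (innerSL ℝ u).hasFDerivAt.comp p ((hasFDerivAt_id p).sub_const O)

lemma contDiff_coord (O u : Plane) : ContDiff ℝ ∞ (coord O u) :=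
  contDiff_const.inner ℝ (contDiff_id.sub contDiff_const)

lemma continuous_coord (O u : Plane) : Continuous (coord O u) := (contDiff_coord O u).continuous

lemma coord_add_smul (O u p w : Plane) (t : ℝ) :
    coord O u (p + t • w) = coord O u p + t * inner ℝ u w := by
  rw [coord, coord, add_sub_right_comm, inner_add_right, inner_smul_right]

/-- The product `sin(j x) sin(k y)` in the coordinates `x = ⟪u, p - O⟫`, `y = ⟪v, p - O⟫`. -/
noncomputable def sinMul (O u v : Plane) (j k : ℤ) (p : Plane) : ℝ :=
  Real.sin (j * coord O u p) * Real.sin (k * coord O v p)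

/-- The antisymmetric mode `sin(j x) sin(k y) - sin(k x) sin(j y)`. -/
noncomputable def mode (O u v : Plane) (j k : ℤ) (p : Plane) : ℝ :=
  sinMul O u v j k p - sinMul O u v k j p

lemma contDiff_sinMul (O u v : Plane) (j k : ℤ) : ContDiff ℝ ∞ (sinMul O u v j k) :=
  (Real.contDiff_sin.comp (contDiff_const.mul (contDiff_coord O u))).mul
    (Real.contDiff_sin.comp (contDiff_const.mul (contDiff_coord O v)))

lemma contDiff_mode (O u v : Plane) (j k : ℤ) : ContDiff ℝ ∞ (mode O u v j k) :=
  (contDiff_sinMul O u v j k).sub (contDiff_sinMul O u v k j)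

lemma hasFDerivAt_sin_coord (O u : Plane) (j : ℤ) (p : Plane) :
    HasFDerivAt (fun q => Real.sin (j * coord O u q))
      ((j * Real.cos (j * coord O u p)) • innerSL ℝ u) p := by
  have h := ((hasFDerivAt_coord O u p).const_mul (j : ℝ)).sin
  rwa [smul_smul, mul_comm] at h

lemma hasFDerivAt_cos_coord (O u : Plane) (j : ℤ) (p : Plane) :
    HasFDerivAt (fun q => Real.cos (j * coord O u q))
      ((-j * Real.sin (j * coord O u p)) • innerSL ℝ u) p := by
  have h := ((hasFDerivAt_coord O u p).const_mul (j : ℝ)).cos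
  rw [smul_smul] at h
  rw [show -(j : ℝ) * Real.sin (j * coord O u p) = -Real.sin (j * coord O u p) * j by ring]
  exact h

lemma fderiv_sinMul (O u v : Plane) (j k : ℤ) (w : Plane) :
    (fun p => fderiv ℝ (sinMul O u v j k) p w) = fun p =>
      j * inner ℝ u w * (Real.cos (j * coord O u p) * Real.sin (k * coord O v p)) +
      k * inner ℝ v w * (Real.sin (j * coord O u p) * Real.cos (k * coord O v p)) := by
  funext p
  have h := ((hasFDerivAt_sin_coord O u j p).mul (hasFDerivAt_sin_coord O v k p)).fderiv
  change fderiv ℝ ((fun q => Real.sin (j * coord O u q)) * fun q => Real.sin (k * coord O v q)) p w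
    = _
  rw [h]
  simp
  ring

/-- The mixed term is isolated with coefficient `⟪u, w⟫ ⟪v, w⟫`; summed over an orthonormal basis it
becomes `⟪u, v⟫ = 0`. -/
lemma fderiv_fderiv_sinMul (O u v : Plane) (j k : ℤ) (p w : Plane) :
    fderiv ℝ (fun q => fderiv ℝ (sinMul O u v j k) q w) p w =
      -(j ^ 2 * inner ℝ u w ^ 2 + k ^ 2 * inner ℝ v w ^ 2) * sinMul O u v j k p +
      2 * j * k * (inner ℝ u w * inner ℝ v w) *
        (Real.cos (j * coord O u p) * Real.cos (k * coord O v p)) := by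
  have h1 := ((hasFDerivAt_cos_coord O u j p).mul (hasFDerivAt_sin_coord O v k p)).const_mul
    (j * inner ℝ u w)
  have h2 := ((hasFDerivAt_sin_coord O u j p).mul (hasFDerivAt_cos_coord O v k p)).const_mul
    (k * inner ℝ v w)
  have h := (h1.add h2).fderiv
  rw [fderiv_sinMul]
  change fderiv ℝ ((fun q => (j * inner ℝ u w) *
    ((fun q => Real.cos (j * coord O u q)) * fun q => Real.sin (k * coord O v q)) q) +
    fun q => (k * inner ℝ v w) *
    ((fun q => Real.sin (j * coord O u q)) * fun q => Real.cos (k * coord O v q)) q) p w = _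
  rw [h]
  simp [sinMul]
  ring

lemma laplacian_sub {f g : Plane → ℝ} (hf : ContDiff ℝ ∞ f) (hg : ContDiff ℝ ∞ g) (p : Plane) :
    laplacian (fun q => f q - g q) p = laplacian f p - laplacian g p := by
  simp only [laplacian]
  rw [← Finset.sum_sub_distrib]
  refine Finset.sum_congr rfl fun i _ => ?_
  have h1 : (fun y => fderiv ℝ (fun q => f q - g q) y (EuclideanSpace.single i 1)) = fun y =>
      fderiv ℝ f y (EuclideanSpace.single i 1) - fderiv ℝ g y (EuclideanSpace.single i 1) := by
    funext y
    rw [fderiv_fun_sub (hf.differentiable (by simp) y) (hg.differentiable (by simp) y)]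
    rfl
  rw [h1, fderiv_fun_sub ((contDiff_fderiv_apply hf _).differentiable (by simp) p)
    ((contDiff_fderiv_apply hg _).differentiable (by simp) p)]
  rfl

/-- `u, v` are orthogonal of length `κ`, and `Ω` is the triangle `0 < y < x < π` in the coordinates
`x = ⟪u, p - O⟫`, `y = ⟪v, p - O⟫`. -/
structure IsTriangleFrame (Ω : Opens Plane) (κ : ℝ) (O u v : Plane) : Prop where
  pos : 0 < κ
  inner_fst : inner ℝ u u = κ ^ 2
  inner_snd : inner ℝ v v = κ ^ 2
  inner_fst_snd : inner ℝ u v = 0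
  mem_iff : ∀ p, p ∈ Ω ↔ 0 < coord O v p ∧ coord O v p < coord O u p ∧ coord O u p < π

/-- Orthogonal rows of equal length force orthogonal columns of the same length: with `D = ad - bc`
one has `k(c, d) = D(-b, a)` and `D² = k²`. -/
lemma orthogonal_transpose {a b c d k : ℝ} (hk : 0 < k) (h1 : a * a + b * b = k)
    (h2 : c * c + d * d = k) (h3 : a * c + b * d = 0) :
    a * a + c * c = k ∧ b * b + d * d = k ∧ a * b + c * d = 0 := by
  have hc : k * c = -b * (a * d - b * c) := by rw [← h1]; linear_combination a * h3
  have hd : k * d = a * (a * d - b * c) := by rw [← h1]; linear_combination b * h3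
  have hD : (a * d - b * c) ^ 2 = k ^ 2 := by
    have : (a * d - b * c) ^ 2 = (a * a + b * b) * (c * c + d * d) - (a * c + b * d) ^ 2 := by ring
    rw [this, h1, h2, h3]; ring
  have hk2 : k ^ 2 ≠ 0 := by positivity
  have e1 : c * c = b * b := mul_left_cancel₀ hk2 (by
    linear_combination (k * c - b * (a * d - b * c)) * hc + b * b * hD)
  have e2 : d * d = a * a := mul_left_cancel₀ hk2 (by
    linear_combination (k * d + a * (a * d - b * c)) * hd + a * a * hD)
  have e3 : c * d = -(a * b) := mul_left_cancel₀ hk2 (by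
    linear_combination (k * d) * hc - b * (a * d - b * c) * hd - a * b * hD)
  exact ⟨by rw [e1, h1], by rw [e2, ← h1]; ring, by rw [e3]; ring⟩

namespace IsTriangleFrame

variable {Ω : Opens Plane} {κ : ℝ} {O u v : Plane} (h : IsTriangleFrame Ω κ O u v)

include h

lemma laplacian_sinMul (j k : ℤ) (p : Plane) :
    laplacian (sinMul O u v j k) p = -(κ ^ 2 * (j ^ 2 + k ^ 2)) * sinMul O u v j k p := by
  have h1 := h.inner_fst
  have h2 := h.inner_snd
  have h3 := h.inner_fst_snd
  simp only [PiLp.inner_apply, Fin.sum_univ_two, RCLike.inner_apply, conj_trivial] at h1 h2 h3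
  simp only [laplacian, fderiv_fderiv_sinMul, Fin.sum_univ_two, EuclideanSpace.inner_single_right]
  simp only [conj_trivial, one_mul]
  linear_combination (-(j : ℝ) ^ 2 * sinMul O u v j k p) * h1 -
    (k : ℝ) ^ 2 * sinMul O u v j k p * h2 +
    2 * j * k * (Real.cos (j * coord O u p) * Real.cos (k * coord O v p)) * h3

lemma laplacian_mode (j k : ℤ) (p : Plane) :
    laplacian (mode O u v j k) p = -(κ ^ 2 * (j ^ 2 + k ^ 2)) * mode O u v j k p := by
  have e := laplacian_sub (contDiff_sinMul O u v j k) (contDiff_sinMul O u v k j) p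
  change laplacian (fun q => sinMul O u v j k q - sinMul O u v k j q) p = _
  rw [e, h.laplacian_sinMul, h.laplacian_sinMul, mode]
  ring

/-- Expansion in the orthogonal basis `u, v`, checked on components with the column relations of
`orthogonal_transpose`. -/
lemma smul_eq (w : Plane) : κ ^ 2 • w = inner ℝ u w • u + inner ℝ v w • v := by
  have h1 := h.inner_fst
  have h2 := h.inner_snd
  have h3 := h.inner_fst_snd
  simp only [PiLp.inner_apply, Fin.sum_univ_two, RCLike.inner_apply, conj_trivial] at h1 h2 h3
  obtain ⟨e1, e2, e3⟩ := orthogonal_transpose (pow_pos h.pos 2) h1 h2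
    (by linear_combination h3)
  ext i
  simp only [PiLp.inner_apply, Fin.sum_univ_two, RCLike.inner_apply, conj_trivial,
    PiLp.add_apply, PiLp.smul_apply, smul_eq_mul]
  fin_cases i
  · simp only [Fin.zero_eta]
    linear_combination (-w 0) * e1 - w 1 * e3
  · simp only [Fin.mk_one]
    linear_combination (-w 1) * e2 - w 0 * e3

lemma eq_of_coord_eq {p q : Plane} (hu : coord O u p = coord O u q)
    (hv : coord O v p = coord O v q) : p = q := by
  have e : κ ^ 2 • (p - O) = κ ^ 2 • (q - O) := by
    rw [h.smul_eq, h.smul_eq]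
    simp only [coord] at hu hv
    rw [hu, hv]
  have hk : κ ^ 2 ≠ 0 := (pow_pos h.pos 2).ne'
  exact sub_left_injective (smul_right_injective Plane hk e)

lemma exists_coord_eq (x y : ℝ) : ∃ p, coord O u p = x ∧ coord O v p = y := by
  have hk : κ ^ 2 ≠ 0 := (pow_pos h.pos 2).ne'
  have h3 : inner ℝ v u = 0 := by rw [real_inner_comm]; exact h.inner_fst_snd
  refine ⟨O + ((x / κ ^ 2) • u + (y / κ ^ 2) • v), ?_, ?_⟩
  · simp only [coord, add_sub_cancel_left, inner_add_right, inner_smul_right, h.inner_fst,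
      h.inner_fst_snd]
    rw [mul_zero, add_zero, div_mul_cancel₀ _ hk]
  · simp only [coord, add_sub_cancel_left, inner_add_right, inner_smul_right, h.inner_snd, h3]
    rw [mul_zero, zero_add, div_mul_cancel₀ _ hk]

/-- The closed triangle. -/
lemma isCompact_closedTriangle :
    IsCompact {p : Plane | 0 ≤ coord O v p ∧ coord O v p ≤ coord O u p ∧ coord O u p ≤ π} := by
  have hu := continuous_coord O u
  have hv := continuous_coord O v
  refine Metric.isCompact_of_isClosed_isBounded ?_ ?_
  · exact (isClosed_le continuous_const hv).inter
      ((isClosed_le hv hu).inter (isClosed_le hu continuous_const))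
  · refine (Metric.isBounded_iff_subset_closedBall O).2 ⟨π * (‖u‖ + ‖v‖) / κ ^ 2, fun p hp => ?_⟩
    obtain ⟨h1, h2, h3⟩ := hp
    have hk : 0 < κ ^ 2 := pow_pos h.pos 2
    rw [mem_closedBall_iff_norm, le_div_iff₀ hk, mul_comm]
    have e : κ ^ 2 * ‖p - O‖ = ‖κ ^ 2 • (p - O)‖ := by
      rw [norm_smul, Real.norm_of_nonneg hk.le]
    rw [e, h.smul_eq]
    refine (norm_add_le _ _).trans ?_
    rw [norm_smul, norm_smul, mul_add]
    have a1 : ‖(inner ℝ u (p - O) : ℝ)‖ ≤ π := by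
      change ‖coord O u p‖ ≤ π
      rw [Real.norm_of_nonneg (h1.trans h2)]; exact h3
    have a2 : ‖(inner ℝ v (p - O) : ℝ)‖ ≤ π := by
      change ‖coord O v p‖ ≤ π
      rw [Real.norm_of_nonneg h1]; exact h2.trans h3
    gcongr

lemma isBounded : Bornology.IsBounded (Ω : Set Plane) :=
  h.isCompact_closedTriangle.isBounded.subset fun p hp =>
    have h1 := (h.mem_iff p).1 hp
    ⟨h1.1.le, h1.2.1.le, h1.2.2.le⟩

omit h in
lemma abs_sin_sub_sin_le (a b : ℝ) : |Real.sin a - Real.sin b| ≤ |a - b| := by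
  have := Real.lipschitzWith_sin.dist_le_mul a b
  simpa [Real.dist_eq] using this

omit h in
-- The mode vanishes on the sides `y = 0`, `x = y` and `x = π`, and sine is 1-Lipschitz. These are
-- the estimates that the cutoff argument requires.
lemma abs_mode_le (j k : ℤ) (p : Plane) :
    |mode O u v j k p| ≤ (|(j : ℝ)| + |(k : ℝ)|) * |coord O v p| ∧
    |mode O u v j k p| ≤ (|(j : ℝ)| + |(k : ℝ)|) * |coord O u p - coord O v p| ∧
    |mode O u v j k p| ≤ (|(j : ℝ)| + |(k : ℝ)|) * |π - coord O u p| := by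
  simp only [mode, sinMul]
  generalize coord O u p = x
  generalize coord O v p = y
  have key : ∀ a b c d A B : ℝ, |a| ≤ A → |b| ≤ 1 → |c| ≤ B → |d| ≤ 1 → |a * b - c * d| ≤ A + B := by
    intro a b c d A B ha hb hc hd
    refine (abs_sub _ _).trans ?_
    rw [abs_mul, abs_mul]
    have := mul_le_mul ha hb (abs_nonneg _) ((abs_nonneg _).trans ha)
    have := mul_le_mul hc hd (abs_nonneg _) ((abs_nonneg _).trans hc)
    linarith
  refine ⟨?_, ?_, ?_⟩
  · rw [add_mul, ← abs_mul, ← abs_mul, add_comm, mul_comm (Real.sin (j * x)),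
      mul_comm (Real.sin (k * x))]
    exact key _ _ _ _ _ _ Real.abs_sin_le_abs (Real.abs_sin_le_one _) Real.abs_sin_le_abs
      (Real.abs_sin_le_one _)
  · rw [add_mul, ← abs_mul, ← abs_mul, mul_sub, mul_sub]
    -- Adding and subtracting `sin(jy) sin(ky)` makes each product contain a difference of the same
    -- sine at `x` and `y`.
    rw [show Real.sin (j * x) * Real.sin (k * y) - Real.sin (k * x) * Real.sin (j * y) =
      (Real.sin (j * x) - Real.sin (j * y)) * Real.sin (k * y) -
      (Real.sin (k * x) - Real.sin (k * y)) * Real.sin (j * y) by ring]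
    exact key _ _ _ _ _ _ (abs_sin_sub_sin_le _ _) (Real.abs_sin_le_one _)
      (abs_sin_sub_sin_le _ _) (Real.abs_sin_le_one _)
  · have hs : ∀ m : ℤ, |Real.sin (m * x)| ≤ |(m : ℝ) * (π - x)| := fun m => by
      have := abs_sin_sub_sin_le (m * x) (m * π)
      rw [Real.sin_int_mul_pi, sub_zero, ← mul_sub] at this
      rwa [← abs_neg ((m : ℝ) * (π - x)), ← mul_neg, neg_sub]
    rw [add_mul, ← abs_mul, ← abs_mul]
    exact key _ _ _ _ _ _ (hs j) (Real.abs_sin_le_one _) (hs k) (Real.abs_sin_le_one _)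

lemma exists_testFunction_tendsto_mode (j k : ℤ) :
    ∃ φ : ℕ → 𝓓(Ω, ℝ),
      Tendsto (fun n => eLpNorm (fun x => φ n x - mode O u v j k x) 2
        (volume.restrict (Ω : Set Plane))) atTop (𝓝 0) ∧
      ∀ w : Plane, Tendsto (fun n => eLpNorm (fun x => fderiv ℝ (φ n) x w -
        fderiv ℝ (mode O u v j k) x w) 2 (volume.restrict (Ω : Set Plane))) atTop (𝓝 0) := by
  refine exists_testFunction_tendsto h.isBounded
    (ℓ := ![coord O v, fun p => coord O u p - coord O v p, fun p => π - coord O u p])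
    (L := ![innerSL ℝ v, innerSL ℝ u - innerSL ℝ v, -innerSL ℝ u]) ?_ ?_ ?_
    (contDiff_mode O u v j k) (C := |(j : ℝ)| + |(k : ℝ)|) ?_
  · intro i
    fin_cases i
    · exact contDiff_coord O v
    · exact (contDiff_coord O u).sub (contDiff_coord O v)
    · exact contDiff_const.sub (contDiff_coord O u)
  · intro i p
    fin_cases i
    · exact hasFDerivAt_coord O v p
    · exact (hasFDerivAt_coord O u p).sub (hasFDerivAt_coord O v p)
    · exact (hasFDerivAt_coord O u p).const_sub π
  · intro p
    rw [h.mem_iff, Fin.forall_fin_succ, Fin.forall_fin_two]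
    simp
  · intro p _ i
    obtain ⟨h1, h2, h3⟩ := abs_mode_le (O := O) (u := u) (v := v) j k p
    fin_cases i
    · exact h1
    · exact h2
    · exact h3

lemma memH10_mode (j k : ℤ) :
    MemH10 (toL2 h.isBounded (contDiff_mode O u v j k).continuous) := by
  obtain ⟨φ, h1, h2⟩ := h.exists_testFunction_tendsto_mode j k
  refine ⟨φ, h1.congr fun n => eLpNorm_congr_ae ?_, fun w =>
    ⟨_, hasWeakDeriv_toL2 h.isBounded (contDiff_mode O u v j k) w,
      (h2 w).congr fun n => eLpNorm_congr_ae ?_⟩⟩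
  · filter_upwards [coeFn_toL2 h.isBounded (contDiff_mode O u v j k).continuous] with x hx
    rw [hx]
  · filter_upwards [coeFn_toL2 h.isBounded
      (contDiff_fderiv_apply (contDiff_mode O u v j k) w).continuous] with x hx
    rw [hx]

lemma toL2_mode_mem_eigenspace (j k : ℤ) :
    toL2 h.isBounded (contDiff_mode O u v j k).continuous ∈
      eigenspace Ω (κ ^ 2 * (j ^ 2 + k ^ 2)) := by
  refine ⟨memH_toL2 _ 2 (contDiff_mode O u v j k), h.memH10_mode j k, _,
    hasWeakLaplacian_toL2 h.isBounded (contDiff_mode O u v j k), Lp.ext ?_⟩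
  filter_upwards [coeFn_toL2 h.isBounded (contDiff_mode O u v j k).continuous,
    coeFn_toL2 h.isBounded (continuous_laplacian (contDiff_mode O u v j k)),
    Lp.coeFn_add (toL2 h.isBounded (continuous_laplacian (contDiff_mode O u v j k)))
      ((κ ^ 2 * ((j : ℝ) ^ 2 + (k : ℝ) ^ 2)) •
        toL2 h.isBounded (contDiff_mode O u v j k).continuous),
    Lp.coeFn_smul (κ ^ 2 * ((j : ℝ) ^ 2 + (k : ℝ) ^ 2))
      (toL2 h.isBounded (contDiff_mode O u v j k).continuous),
    Lp.coeFn_zero ℝ 2 (volume.restrict (Ω : Set Plane))] with x h1 h2 h3 h4 h5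
  rw [h3, Pi.add_apply, h4, Pi.smul_apply, h1, h2, h5, h.laplacian_mode]
  simp

/-- Symmetry of the Laplacian: moving both derivatives from `w` to the mode yields two different
multiples of the same integral. -/
lemma integral_mode_mul_eq_zero {μ : ℝ} {w : L2 Ω} (hw : w ∈ eigenspace Ω μ) {j k : ℤ}
    (hμ : κ ^ 2 * ((j : ℝ) ^ 2 + (k : ℝ) ^ 2) ≠ μ) :
    ∫ x in (Ω : Set Plane), mode O u v j k x * w x = 0 := by
  have hb := h.isBounded
  obtain ⟨-, h0, f, ⟨g, d, hgd, rfl⟩, hf⟩ := hw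
  obtain ⟨φ, hφ, hφd⟩ := h.exists_testFunction_tendsto_mode j k
  have hm := contDiff_mode O u v j k
  -- The two integrations by parts have different justifications. The weak gradient of `w` need not
  -- vanish on the boundary, so there the mode is approximated by test functions; for the other one,
  -- `w ∈ H¹₀` is used.
  have key : ∀ i : Fin 2, ∫ x in (Ω : Set Plane), d i x * mode O u v j k x =
      ∫ x in (Ω : Set Plane), fderiv ℝ (fun y => fderiv ℝ (mode O u v j k) y
        (EuclideanSpace.single i 1)) x (EuclideanSpace.single i 1) * w x := fun i => by
    rw [h0.setIntegral_mul_fderiv hb (hgd i).1 (contDiff_fderiv_apply hm _),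
      ← neg_eq_iff_eq_neg.2 ((hgd i).2.setIntegral_mul_of_tendsto hb hm hφ (hφd _))]
    congr 1
    exact integral_congr_ae (Eventually.of_forall fun x => mul_comm _ _)
  have hint : ∀ (w : L2 Ω) {F : Plane → ℝ}, Continuous F →
      IntegrableOn (fun x => F x * w x) (Ω : Set Plane) := fun w F hF =>
    (memLp_of_continuous hb hF).integrable_mul (Lp.memLp w)
  have hint' : ∀ (w : L2 Ω) {F : Plane → ℝ}, Continuous F →
      IntegrableOn (fun x => w x * F x) (Ω : Set Plane) := fun w F hF =>
    (Lp.memLp w).integrable_mul (memLp_of_continuous hb hF)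
  have e1 : ∫ x in (Ω : Set Plane), (∑ i, d i : L2 Ω) x * mode O u v j k x =
      -(κ ^ 2 * ((j : ℝ) ^ 2 + (k : ℝ) ^ 2)) * ∫ x in (Ω : Set Plane), mode O u v j k x * w x := by
    have a1 : ∫ x in (Ω : Set Plane), (∑ i, d i : L2 Ω) x * mode O u v j k x =
        ∫ x in (Ω : Set Plane), (d 0 x * mode O u v j k x + d 1 x * mode O u v j k x) := by
      refine integral_congr_ae ?_
      rw [Fin.sum_univ_two]
      filter_upwards [Lp.coeFn_add (d 0) (d 1)] with x hx
      rw [hx, Pi.add_apply, add_mul]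
    rw [a1, integral_add (hint' _ hm.continuous) (hint' _ hm.continuous), key, key,
      ← integral_add (hint _ (contDiff_fderiv_apply (contDiff_fderiv_apply hm _) _).continuous)
        (hint _ (contDiff_fderiv_apply (contDiff_fderiv_apply hm _) _).continuous),
      ← integral_const_mul]
    refine integral_congr_ae (Eventually.of_forall fun x => ?_)
    have e := h.laplacian_mode j k x
    rw [laplacian, Fin.sum_univ_two] at e
    simp only []
    rw [← add_mul, e, mul_assoc]
  have e2 : ∫ x in (Ω : Set Plane), (∑ i, d i : L2 Ω) x * mode O u v j k x =
      -μ * ∫ x in (Ω : Set Plane), mode O u v j k x * w x := by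
    rw [eq_neg_of_add_eq_zero_left hf, ← neg_smul, ← integral_const_mul]
    refine integral_congr_ae ?_
    filter_upwards [Lp.coeFn_smul (-μ) w] with x hx
    rw [hx, Pi.smul_apply, smul_eq_mul]
    ring
  have e3 : (κ ^ 2 * ((j : ℝ) ^ 2 + (k : ℝ) ^ 2) - μ) *
      ∫ x in (Ω : Set Plane), mode O u v j k x * w x = 0 := by linear_combination e1.symm.trans e2 * (-1)
  exact (mul_eq_zero.1 e3).resolve_left (sub_ne_zero.2 hμ)

end IsTriangleFrame

end Modes

end DirichletLaplacian

namespace DirichletLaplacian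

open Set
open scoped Real

/-! ### Completeness of the modes by Stone-Weierstrass. -/

section Completeness

variable {O u v : Plane}

lemma mode_swap (j k : ℤ) (p : Plane) : mode O u v j k p = -mode O u v k j p := by
  simp [mode]

lemma mode_neg_left (j k : ℤ) (p : Plane) : mode O u v (-j) k p = -mode O u v j k p := by
  simp [mode, sinMul]; ring

/-- The linear span of the modes. -/
noncomputable def modeSpan (O u v : Plane) : Submodule ℝ (Plane → ℝ) :=
  Submodule.span ℝ (range fun q : ℤ × ℤ => mode O u v q.1 q.2)

lemma mode_mem_modeSpan (j k : ℤ) : mode O u v j k ∈ modeSpan O u v :=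
  Submodule.subset_span ⟨(j, k), rfl⟩

/-- The continuous functions that multiply the span of the modes into itself. -/
noncomputable def modeMultipliers (O u v : Plane) : Subalgebra ℝ C(Plane, ℝ) where
  carrier := {q | ∀ f ∈ modeSpan O u v, (q : Plane → ℝ) * f ∈ modeSpan O u v}
  mul_mem' := by
    intro q r hq hr f hf
    rw [ContinuousMap.coe_mul, mul_assoc]
    exact hq _ (hr f hf)
  add_mem' := by
    intro q r hq hr f hf
    rw [ContinuousMap.coe_add, add_mul]
    exact Submodule.add_mem _ (hq f hf) (hr f hf)
  algebraMap_mem' := by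
    intro c f hf
    have : ((algebraMap ℝ C(Plane, ℝ) c : C(Plane, ℝ)) : Plane → ℝ) * f = c • f := by
      ext x; simp
    rw [this]
    exact Submodule.smul_mem _ c hf

lemma mem_modeMultipliers {q : C(Plane, ℝ)}
    (hq : ∀ j k : ℤ, (q : Plane → ℝ) * mode O u v j k ∈ modeSpan O u v) :
    q ∈ modeMultipliers O u v := by
  intro f hf
  induction hf using Submodule.span_induction with
  | mem f hf => obtain ⟨⟨j, k⟩, rfl⟩ := hf; exact hq j k
  | zero => rw [mul_zero]; exact Submodule.zero_mem _
  | add f g _ _ hf hg => rw [mul_add]; exact Submodule.add_mem _ hf hg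
  | smul c f _ hf => rw [mul_smul_comm]; exact Submodule.smul_mem _ c hf

/-- The symmetric function `cos x + cos y`. -/
noncomputable def cosAdd (O u v : Plane) : C(Plane, ℝ) :=
  ⟨fun p => Real.cos (coord O u p) + Real.cos (coord O v p),
    (Real.continuous_cos.comp (continuous_coord O u)).add
      (Real.continuous_cos.comp (continuous_coord O v))⟩

/-- The symmetric function `cos x cos y`. -/
noncomputable def cosMul (O u v : Plane) : C(Plane, ℝ) :=
  ⟨fun p => Real.cos (coord O u p) * Real.cos (coord O v p),
    (Real.continuous_cos.comp (continuous_coord O u)).mul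
      (Real.continuous_cos.comp (continuous_coord O v))⟩

/-- Product-to-sum formulas shift the indices by one. Shifts may produce zero, equal or negative
indices, which is why the span runs over all integer pairs. -/
lemma cosAdd_mem_modeMultipliers : cosAdd O u v ∈ modeMultipliers O u v := by
  refine mem_modeMultipliers fun j k => ?_
  have e : (cosAdd O u v : Plane → ℝ) * mode O u v j k = (1 / 2 : ℝ) •
      (mode O u v (j + 1) k + mode O u v (j - 1) k + mode O u v j (k + 1) +
        mode O u v j (k - 1)) := by
    ext p
    simp [cosAdd, mode, sinMul, add_mul, sub_mul, Real.sin_add, Real.sin_sub]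
    ring
  rw [e]
  exact Submodule.smul_mem _ _ (Submodule.add_mem _ (Submodule.add_mem _ (Submodule.add_mem _
    (mode_mem_modeSpan _ _) (mode_mem_modeSpan _ _)) (mode_mem_modeSpan _ _))
    (mode_mem_modeSpan _ _))

lemma cosMul_mem_modeMultipliers : cosMul O u v ∈ modeMultipliers O u v := by
  refine mem_modeMultipliers fun j k => ?_
  have e : (cosMul O u v : Plane → ℝ) * mode O u v j k = (1 / 4 : ℝ) •
      (mode O u v (j + 1) (k + 1) + mode O u v (j - 1) (k + 1) + mode O u v (j + 1) (k - 1) +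
        mode O u v (j - 1) (k - 1)) := by
    ext p
    simp [cosMul, mode, sinMul, add_mul, sub_mul, Real.sin_add, Real.sin_sub]
    ring
  rw [e]
  exact Submodule.smul_mem _ _ (Submodule.add_mem _ (Submodule.add_mem _ (Submodule.add_mem _
    (mode_mem_modeSpan _ _) (mode_mem_modeSpan _ _)) (mode_mem_modeSpan _ _))
    (mode_mem_modeSpan _ _))

/-- Both pairs are the ordered roots of the same quadratic polynomial. -/
lemma eq_and_eq_of_add_eq_of_mul_eq {a b c d : ℝ} (hab : a ≤ b) (hcd : c ≤ d)
    (h1 : a + b = c + d) (h2 : a * b = c * d) : a = c ∧ b = d := by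
  have h : (a - c) * (a - d) = 0 := by linear_combination -h2 + a * h1
  rcases mul_eq_zero.1 h with h | h
  · exact ⟨by linarith, by linarith⟩
  · exact ⟨by linarith, by linarith⟩

namespace IsTriangleFrame

variable {Ω : Opens Plane} {κ : ℝ} (h : IsTriangleFrame Ω κ O u v)

include h

/-- On the closed triangle `cos x ≤ cos y`, so sum and product recover the two cosines in order, and
cosine is injective on `[0, π]`. -/
lemma eq_of_cos_eq {p q : Plane}
    (hp : 0 ≤ coord O v p ∧ coord O v p ≤ coord O u p ∧ coord O u p ≤ π)
    (hq : 0 ≤ coord O v q ∧ coord O v q ≤ coord O u q ∧ coord O u q ≤ π)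
    (h1 : cosAdd O u v p = cosAdd O u v q) (h2 : cosMul O u v p = cosMul O u v q) : p = q := by
  have hc : ∀ r : Plane, 0 ≤ coord O v r ∧ coord O v r ≤ coord O u r ∧ coord O u r ≤ π →
      Real.cos (coord O u r) ≤ Real.cos (coord O v r) := fun r hr =>
    Real.cos_le_cos_of_nonneg_of_le_pi hr.1 hr.2.2 hr.2.1
  obtain ⟨e1, e2⟩ := eq_and_eq_of_add_eq_of_mul_eq (hc p hp) (hc q hq) h1 h2
  refine h.eq_of_coord_eq (Real.injOn_cos ⟨hp.1.trans hp.2.1, hp.2.2⟩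
    ⟨hq.1.trans hq.2.1, hq.2.2⟩ e1) (Real.injOn_cos ⟨hp.1, hp.2.1.trans hp.2.2⟩
    ⟨hq.1, hq.2.1.trans hq.2.2⟩ e2)

lemma exists_modeMultiplier_near (g : C(Plane, ℝ)) {ε : ℝ} (hε : 0 < ε) :
    ∃ q ∈ modeMultipliers O u v, ∀ p ∈ Ω, |q p - g p| < ε := by
  set K : Set Plane := {p | 0 ≤ coord O v p ∧ coord O v p ≤ coord O u p ∧ coord O u p ≤ π} with hK
  have : CompactSpace K := isCompact_iff_compactSpace.1 h.isCompact_closedTriangle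
  let res : C(Plane, ℝ) →ₐ[ℝ] C(K, ℝ) :=
    ContinuousMap.compRightAlgHom ℝ ℝ ⟨Subtype.val, continuous_subtype_val⟩
  have hsep : ((modeMultipliers O u v).map res).SeparatesPoints := by
    intro p q hpq
    by_contra hcon
    push Not at hcon
    have hmem : ∀ f ∈ modeMultipliers O u v, f p.1 = f q.1 := fun f hf =>
      hcon (res f) ⟨res f, ⟨f, hf, rfl⟩, rfl⟩
    exact hpq (Subtype.ext (h.eq_of_cos_eq p.2 q.2 (hmem _ cosAdd_mem_modeMultipliers)
      (hmem _ cosMul_mem_modeMultipliers)))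
  obtain ⟨⟨_, q, hq, rfl⟩, hqg⟩ :=
    ContinuousMap.exists_mem_subalgebra_near_continuous_of_separatesPoints _ hsep
      (fun p : K => g p) (g.continuous.comp continuous_subtype_val) ε hε
  refine ⟨q, hq, fun p hp => ?_⟩
  have h1 := (h.mem_iff p).1 hp
  exact hqg ⟨p, h1.1.le, h1.2.1.le, h1.2.2.le⟩

/-- This mode is `2 sin x sin y (cos x - cos y)`, which has no zeros in the open triangle; it can
therefore be divided out at the end of the completeness proof. -/
lemma mode_two_one_ne_zero {p : Plane} (hp : p ∈ Ω) : mode O u v 2 1 p ≠ 0 := by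
  obtain ⟨h1, h2, h3⟩ := (h.mem_iff p).1 hp
  have e : mode O u v 2 1 p = 2 * Real.sin (coord O u p) * Real.sin (coord O v p) *
      (Real.cos (coord O u p) - Real.cos (coord O v p)) := by
    simp [mode, sinMul, Real.sin_two_mul]
    ring
  rw [e]
  have s1 := Real.sin_pos_of_pos_of_lt_pi (h1.trans h2) h3
  have s2 := Real.sin_pos_of_pos_of_lt_pi h1 (h2.trans h3)
  have s3 := Real.cos_lt_cos_of_nonneg_of_le_pi h1.le h3.le h2
  exact mul_ne_zero (by positivity) (sub_ne_zero.2 s3.ne)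

lemma integrable_mode_mul (w : L2 Ω) (j k : ℤ) :
    IntegrableOn (fun x => mode O u v j k x * w x) (Ω : Set Plane) :=
  (memLp_of_continuous h.isBounded (contDiff_mode O u v j k).continuous).integrable_mul (Lp.memLp w)

lemma integral_modeSpan_mul {w : L2 Ω}
    (hw : ∀ j k : ℤ, ∫ x in (Ω : Set Plane), mode O u v j k x * w x = 0) {f : Plane → ℝ}
    (hf : f ∈ modeSpan O u v) : IntegrableOn (fun x => f x * w x) (Ω : Set Plane) ∧
      ∫ x in (Ω : Set Plane), f x * w x = 0 := by
  induction hf using Submodule.span_induction with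
  | mem f hf => obtain ⟨⟨j, k⟩, rfl⟩ := hf; exact ⟨h.integrable_mode_mul w j k, hw j k⟩
  | zero => simp
  | add f g _ _ hf hg =>
    simp only [Pi.add_apply, add_mul]
    exact ⟨hf.1.add hg.1, by rw [integral_add hf.1 hg.1, hf.2, hg.2, add_zero]⟩
  | smul c f _ hf =>
    simp only [Pi.smul_apply, smul_eq_mul, mul_assoc]
    exact ⟨hf.1.const_mul c, by rw [integral_const_mul, hf.2, mul_zero]⟩

omit h in
-- Modes are antisymmetric under exchanging the indices and odd in each of them, so every integer
-- pair reduces to `m > n ≥ 1` or gives zero.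
lemma integral_mode_eq_zero_of_octant {w : L2 Ω}
    (hw : ∀ p : Octant, ∫ x in (Ω : Set Plane), mode O u v p.1.1 p.1.2 x * w x = 0) (j k : ℤ) :
    ∫ x in (Ω : Set Plane), mode O u v j k x * w x = 0 := by
  set I : ℤ → ℤ → ℝ := fun j k => ∫ x in (Ω : Set Plane), mode O u v j k x * w x with hI
  have hswap : ∀ j k, I j k = -I k j := fun j k => by
    simp only [hI]
    rw [← integral_neg]
    refine integral_congr_ae (Eventually.of_forall fun x => ?_)
    simp only [mode_swap j k, neg_mul]
  have hneg : ∀ j k, I (-j) k = -I j k := fun j k => by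
    simp only [hI]
    rw [← integral_neg]
    refine integral_congr_ae (Eventually.of_forall fun x => ?_)
    simp only [mode_neg_left j k, neg_mul]
  have hzero : ∀ k, I 0 k = 0 := fun k => by
    have := hneg 0 k
    rw [neg_zero] at this
    linarith
  have hlt : ∀ m n : ℕ, n < m → I m n = 0 := fun m n hmn => by
    rcases Nat.eq_zero_or_pos n with rfl | hn
    · rw [hswap, Nat.cast_zero, hzero, neg_zero]
    · exact hw ⟨(⟨m, hn.trans hmn⟩, ⟨n, hn⟩), hmn⟩
  have hnat : ∀ m n : ℕ, I m n = 0 := fun m n => by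
    rcases lt_trichotomy m n with hmn | rfl | hmn
    · rw [hswap, hlt n m hmn, neg_zero]
    · have := hswap m m
      linarith
    · exact hlt m n hmn
  have hint : ∀ (j : ℤ) (n : ℕ), I j n = 0 := fun j n => by
    rcases Int.natAbs_eq j with hj | hj
    · rw [hj, hnat]
    · rw [hj, hneg, hnat, neg_zero]
  change I j k = 0
  rcases Int.natAbs_eq k with hk | hk
  · rw [hk, hint]
  · rw [hk, hswap, hneg, hswap, hint, neg_zero, neg_zero, neg_zero]

/-- The modes are complete in `L²(Ω)`. -/
lemma eq_zero_of_integral_mode_eq_zero {w : L2 Ω}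
    (hw : ∀ p : Octant, ∫ x in (Ω : Set Plane), mode O u v p.1.1 p.1.2 x * w x = 0) : w = 0 := by
  have hw' := integral_mode_eq_zero_of_octant hw
  set W : Plane → ℝ := fun x => mode O u v 2 1 x * w x with hW
  have hWi : IntegrableOn W (Ω : Set Plane) := h.integrable_mode_mul w 2 1
  have hb := h.isBounded
  -- A multiplier times the mode `(2, 1)` stays in the span, so `W` is orthogonal to all
  -- multipliers. These are uniformly dense, hence `W` is orthogonal to every continuous function.
  have hg : ∀ g : C(Plane, ℝ), ∫ x in (Ω : Set Plane), W x * g x = 0 := by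
    intro g
    have hbound : ∀ ε > 0, |∫ x in (Ω : Set Plane), W x * g x| ≤
        ε * ∫ x in (Ω : Set Plane), ‖W x‖ := by
      intro ε hε
      obtain ⟨q, hq, hqg⟩ := h.exists_modeMultiplier_near g hε
      obtain ⟨i1, i2⟩ := h.integral_modeSpan_mul hw' (hq _ (mode_mem_modeSpan 2 1))
      have hae : ∀ᵐ x ∂(volume.restrict (Ω : Set Plane)), ‖W x * (g x - q x)‖ ≤ ε * ‖W x‖ := by
        filter_upwards [ae_restrict_mem Ω.isOpen.measurableSet] with x hx
        rw [norm_mul, mul_comm, Real.norm_eq_abs (g x - q x), abs_sub_comm]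
        exact mul_le_mul_of_nonneg_right (hqg x hx).le (norm_nonneg _)
      have i3 : IntegrableOn (fun x => W x * (g x - q x)) (Ω : Set Plane) := by
        refine Integrable.mono' (hWi.norm.const_mul ε) (hWi.aestronglyMeasurable.mul
          ((g.continuous.sub q.continuous).aestronglyMeasurable)) hae
      have e : ∫ x in (Ω : Set Plane), W x * g x = ∫ x in (Ω : Set Plane), W x * (g x - q x) := by
        have e1 : ∫ x in (Ω : Set Plane), W x * g x =
            ∫ x in (Ω : Set Plane), (W x * (g x - q x) + ((q : Plane → ℝ) * mode O u v 2 1) x * w x) := by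
          refine integral_congr_ae (Eventually.of_forall fun x => ?_)
          simp only [hW, Pi.mul_apply]
          ring
        rw [e1, integral_add i3 i1, i2, add_zero]
      rw [e, ← integral_const_mul, ← Real.norm_eq_abs]
      exact norm_integral_le_of_norm_le (hWi.norm.const_mul ε) hae
    have hlim : Tendsto (fun ε : ℝ => ε * ∫ x in (Ω : Set Plane), ‖W x‖) (𝓝[>] 0)
        (𝓝 (0 * ∫ x in (Ω : Set Plane), ‖W x‖)) :=
      (tendsto_id.mono_left nhdsWithin_le_nhds).mul_const _
    rw [zero_mul] at hlim
    refine abs_eq_zero.1 (le_antisymm (ge_of_tendsto hlim ?_) (abs_nonneg _))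
    filter_upwards [self_mem_nhdsWithin] with ε hε using hbound ε hε
  have h0 := ae_eq_zero_of_integral_testFunction hWi fun φ => hg ⟨φ, φ.continuous⟩
  refine Lp.eq_zero_iff_ae_eq_zero.2 ?_
  filter_upwards [h0, ae_restrict_mem Ω.isOpen.measurableSet] with x hx hxΩ
  exact (mul_eq_zero.1 hx).resolve_left (h.mode_two_one_ne_zero hxΩ)

end IsTriangleFrame

end Completeness

/-! ### Linear independence of the modes and determination of the eigenspaces. -/

section Independence

lemma integral_cos_int_mul {c : ℤ} (hc : c ≠ 0) : ∫ x in (0 : ℝ)..π, Real.cos (c * x) = 0 := by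
  have hc' : (c : ℝ) ≠ 0 := by exact_mod_cast hc
  rw [intervalIntegral.integral_comp_mul_left (fun x => Real.cos x) hc', integral_cos,
    Real.sin_int_mul_pi]
  simp

lemma integral_sin_mul_sin (m k : ℕ+) :
    ∫ x in (0 : ℝ)..π, Real.sin (m * x) * Real.sin (k * x) = if m = k then π / 2 else 0 := by
  have e : ∀ x : ℝ, Real.sin (m * x) * Real.sin (k * x) =
      (Real.cos (((m : ℤ) - (k : ℤ) : ℤ) * x) - Real.cos (((m : ℤ) + (k : ℤ) : ℤ) * x)) / 2 := by
    intro x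
    push_cast
    rw [sub_mul, add_mul, Real.cos_sub, Real.cos_add]
    ring
  simp only [e]
  rw [intervalIntegral.integral_div, intervalIntegral.integral_sub
    (Continuous.intervalIntegrable (by fun_prop) _ _)
    (Continuous.intervalIntegrable (by fun_prop) _ _),
    integral_cos_int_mul (c := (m : ℤ) + (k : ℤ)) (by have := m.pos; have := k.pos; omega)]
  split_ifs with hmk
  · subst hmk; simp
  · rw [integral_cos_int_mul]
    · simp
    · intro h
      exact hmk (PNat.coe_injective (by omega))

lemma coeFn_sum_smul_toL2 {Ω : Opens Plane} (hb : Bornology.IsBounded (Ω : Set Plane)) {ι : Type*}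
    (s : Finset ι) (c : ι → ℝ) {f : ι → Plane → ℝ} (hf : ∀ i, Continuous (f i)) :
    (∑ i ∈ s, c i • toL2 hb (hf i) : L2 Ω) =ᵐ[volume.restrict (Ω : Set Plane)]
      fun x => ∑ i ∈ s, c i * f i x := by
  classical
  induction s using Finset.induction_on with
  | empty =>
    simp only [Finset.sum_empty]
    exact Lp.coeFn_zero ℝ 2 _
  | insert i s hi ih =>
    simp only [Finset.sum_insert hi]
    filter_upwards [ih, Lp.coeFn_add (c i • toL2 hb (hf i)) (∑ i ∈ s, c i • toL2 hb (hf i)),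
      Lp.coeFn_smul (c i) (toL2 hb (hf i)), coeFn_toL2 hb (hf i)] with x h1 h2 h3 h4
    rw [h2, Pi.add_apply, h1, h3, Pi.smul_apply, h4, smul_eq_mul]

/-- A relation between modes of the same eigenvalue on the triangle `0 < y < x < π` is trivial. -/
lemma eq_zero_of_sum_sin_eq_zero {μ a : ℝ} (ha : 0 < a)
    (s : Finset {p : Octant // eigval a p = μ}) (c : {p : Octant // eigval a p = μ} → ℝ)
    (hz : ∀ x y : ℝ, 0 < y → y < x → x < π → ∑ i ∈ s, c i *
      (Real.sin (i.1.1.1 * x) * Real.sin (i.1.1.2 * y) -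
        Real.sin (i.1.1.2 * x) * Real.sin (i.1.1.1 * y)) = 0)
    (j : {p : Octant // eigval a p = μ}) (hj : j ∈ s) : c j = 0 := by
  -- Antisymmetry in `x` and `y` extends the relation from the triangle to the whole square, where
  -- the sines are orthogonal.
  have hsq : ∀ x ∈ Ioo 0 π, ∀ y ∈ Ioo 0 π, ∑ i ∈ s, c i *
      (Real.sin (i.1.1.1 * x) * Real.sin (i.1.1.2 * y) -
        Real.sin (i.1.1.2 * x) * Real.sin (i.1.1.1 * y)) = 0 := by
    intro x hx y hy
    rcases lt_trichotomy x y with hxy | rfl | hxy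
    · rw [← neg_eq_zero, ← Finset.sum_neg_distrib, ← hz y x hx.1 hxy hy.2]
      exact Finset.sum_congr rfl fun i _ => by ring
    · exact Finset.sum_eq_zero fun i _ => by ring
    · exact hz x y hy.1 hxy hx.2
  have hμ : ∀ i : {p : Octant // eigval a p = μ},
      (i.1.1.1 : ℕ) ^ 2 + (i.1.1.2 : ℕ) ^ 2 = (j.1.1.1 : ℕ) ^ 2 + (j.1.1.2 : ℕ) ^ 2 := by
    intro i
    have e := i.2.trans j.2.symm
    have hk : (π / a) ^ 2 ≠ 0 := by positivity
    have := mul_left_cancel₀ hk e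
    exact_mod_cast this
  -- For a fixed value of `m² + n²` the larger index determines the pair.
  have h1 : ∀ i : {p : Octant // eigval a p = μ}, j.1.1.1 = i.1.1.1 ↔ i = j := by
    intro i
    refine ⟨fun e => ?_, fun e => by rw [e]⟩
    have := hμ i
    rw [← e] at this
    have e2 : (i.1.1.2 : ℕ) = j.1.1.2 := by nlinarith
    exact Subtype.ext (Subtype.ext (Prod.ext e.symm (PNat.coe_injective e2)))
  -- If the larger index of one pair were the smaller index of another, the second sum of squares
  -- would be strictly larger.
  have h2 : ∀ i : {p : Octant // eigval a p = μ}, j.1.1.1 ≠ i.1.1.2 := by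
    intro i e
    have h3 : (i.1.1.2 : ℕ) < i.1.1.1 := i.1.2
    have h4 : (j.1.1.2 : ℕ) < j.1.1.1 := j.1.2
    have := hμ i
    rw [e] at this h4
    nlinarith
  -- Chosen so that `sin(n y) = 1` for the second index `n` of `j`; integrating against `sin(m x)`
  -- then isolates `c j * (π / 2)`.
  set y : ℝ := π / (2 * j.1.1.2) with hy
  have hn : (1 : ℝ) ≤ j.1.1.2 := by exact_mod_cast j.1.1.2.2
  have hy0 : y ∈ Ioo 0 π := by
    refine ⟨by positivity, ?_⟩
    rw [hy, div_lt_iff₀ (by positivity)]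
    nlinarith [Real.pi_pos]
  have hsin : Real.sin (j.1.1.2 * y) = 1 := by
    rw [hy, show (j.1.1.2 : ℝ) * (π / (2 * j.1.1.2)) = π / 2 by field_simp, Real.sin_pi_div_two]
  have hI : ∫ x in (0 : ℝ)..π, Real.sin (j.1.1.1 * x) * ∑ i ∈ s, c i *
      (Real.sin (i.1.1.1 * x) * Real.sin (i.1.1.2 * y) -
        Real.sin (i.1.1.2 * x) * Real.sin (i.1.1.1 * y)) = 0 := by
    rw [intervalIntegral.integral_of_le Real.pi_pos.le, integral_Ioc_eq_integral_Ioo]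
    exact setIntegral_eq_zero_of_forall_eq_zero fun x hx => by rw [hsq x hx y hy0, mul_zero]
  have e : ∀ x : ℝ, Real.sin (j.1.1.1 * x) * ∑ i ∈ s, c i *
      (Real.sin (i.1.1.1 * x) * Real.sin (i.1.1.2 * y) -
        Real.sin (i.1.1.2 * x) * Real.sin (i.1.1.1 * y)) = ∑ i ∈ s,
      (c i * Real.sin (i.1.1.2 * y) * (Real.sin (j.1.1.1 * x) * Real.sin (i.1.1.1 * x)) -
        c i * Real.sin (i.1.1.1 * y) * (Real.sin (j.1.1.1 * x) * Real.sin (i.1.1.2 * x))) := by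
    intro x
    rw [Finset.mul_sum]
    exact Finset.sum_congr rfl fun i _ => by ring
  simp only [e] at hI
  rw [intervalIntegral.integral_finsetSum fun i _ =>
    Continuous.intervalIntegrable (by fun_prop) _ _] at hI
  have e3 : ∀ i ∈ s, (∫ x in (0 : ℝ)..π,
      (c i * Real.sin (i.1.1.2 * y) * (Real.sin (j.1.1.1 * x) * Real.sin (i.1.1.1 * x)) -
        c i * Real.sin (i.1.1.1 * y) * (Real.sin (j.1.1.1 * x) * Real.sin (i.1.1.2 * x)))) =
      if i = j then c j * (π / 2) else 0 := by
    intro i _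
    rw [intervalIntegral.integral_sub (Continuous.intervalIntegrable (by fun_prop) _ _)
      (Continuous.intervalIntegrable (by fun_prop) _ _), intervalIntegral.integral_const_mul,
      intervalIntegral.integral_const_mul, integral_sin_mul_sin, integral_sin_mul_sin,
      if_neg (h2 i), mul_zero, sub_zero]
    by_cases hij : i = j
    · rw [if_pos ((h1 i).2 hij), if_pos hij, hij, hsin, mul_one]
    · rw [if_neg (fun hh => hij ((h1 i).1 hh)), if_neg hij, mul_zero]
  rw [Finset.sum_congr rfl e3, Finset.sum_ite_eq' s j, if_pos hj] at hI
  exact (mul_eq_zero.1 hI).resolve_right (by positivity)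

namespace IsTriangleFrame

variable {Ω : Opens Plane} {a : ℝ} {O u v : Plane} (h : IsTriangleFrame Ω (π / a) O u v)

/-- The mode of an octant pair as an element of `L²(Ω)`. -/
noncomputable def octantMode (p : Octant) : L2 Ω :=
  toL2 h.isBounded (contDiff_mode O u v p.1.1 p.1.2).continuous

include h

lemma octantMode_mem_eigenspace (p : Octant) : h.octantMode p ∈ eigenspace Ω (eigval a p) := by
  have := h.toL2_mode_mem_eigenspace p.1.1 p.1.2
  simpa [eigval] using! this

/-- A relation in `L²` holds almost everywhere, hence by continuity at every point of the open
triangle. -/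
lemma linearIndependent_octantMode (ha : 0 < a) (μ : ℝ) :
    LinearIndependent ℝ fun p : {p : Octant // eigval a p = μ} => h.octantMode p := by
  rw [linearIndependent_iff']
  intro s c hc
  refine eq_zero_of_sum_sin_eq_zero ha s c fun x y hy hxy hx => ?_
  have h1 := coeFn_sum_smul_toL2 h.isBounded s c
    (f := fun i : {p : Octant // eigval a p = μ} => mode O u v i.1.1.1 i.1.1.2)
    fun i => (contDiff_mode O u v _ _).continuous
  change ((∑ i ∈ s, c i • h.octantMode i : L2 Ω) : Plane → ℝ) =ᵐ[_] _ at h1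
  rw [hc] at h1
  have h2 : (fun p => ∑ i ∈ s, c i * mode O u v i.1.1.1 i.1.1.2 p)
      =ᵐ[volume.restrict (Ω : Set Plane)] fun _ => 0 :=
    h1.symm.trans (Lp.coeFn_zero ℝ 2 _)
  have h3 := Measure.eqOn_open_of_ae_eq h2 Ω.isOpen
    (continuous_finsetSum _ fun i _ => continuous_const.mul
      (contDiff_mode O u v _ _).continuous).continuousOn continuous_const.continuousOn
  obtain ⟨p, hpx, hpy⟩ := h.exists_coord_eq x y
  have h4 := h3 ((h.mem_iff p).2 (by rw [hpx, hpy]; exact ⟨hy, hxy, hx⟩))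
  simpa [mode, sinMul, hpx, hpy] using h4

/-- The component of an eigenfunction orthogonal to the span is again an eigenfunction. It is
orthogonal to the modes of eigenvalue `μ` by construction and to all others by Green's formula, so
completeness makes it zero. -/
lemma eigenspace_eq_span (ha : 0 < a) (μ : ℝ) :
    eigenspace Ω μ = Submodule.span ℝ
      (range fun p : {p : Octant // eigval a p = μ} => h.octantMode p) := by
  have := finite_eigval_fiber ha μ
  set V := Submodule.span ℝ (range fun p : {p : Octant // eigval a p = μ} => h.octantMode p) with hV
  have hVE : V ≤ eigenspace Ω μ := by
    rw [hV, Submodule.span_le]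
    rintro _ ⟨⟨p, rfl⟩, rfl⟩
    exact h.octantMode_mem_eigenspace p
  have : FiniteDimensional ℝ V := FiniteDimensional.span_of_finite ℝ (finite_range _)
  refine le_antisymm (fun w hw => ?_) hVE
  obtain ⟨y, hy, z, hz, rfl⟩ := V.exists_add_mem_mem_orthogonal w
  have hzE : z ∈ eigenspace Ω μ := by
    have := Submodule.sub_mem _ hw (hVE hy)
    rwa [add_sub_cancel_left] at this
  have hz0 : z = 0 := by
    refine h.eq_zero_of_integral_mode_eq_zero fun p => ?_
    by_cases hp : eigval a p = μ
    · have h1 := (Submodule.mem_orthogonal V z).1 hz (h.octantMode p)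
        (Submodule.subset_span ⟨⟨p, hp⟩, rfl⟩)
      rw [L2.inner_def] at h1
      rw [← h1]
      refine integral_congr_ae ?_
      filter_upwards [coeFn_toL2 h.isBounded (contDiff_mode O u v p.1.1 p.1.2).continuous] with x hx
      rw [octantMode, hx]
      exact mul_comm _ _
    · refine h.integral_mode_mul_eq_zero hzE fun e => hp ?_
      rw [← e, eigval]
      simp
  rw [hz0, add_zero]
  exact hy

lemma finiteDimensional_eigenspace (ha : 0 < a) (μ : ℝ) :
    FiniteDimensional ℝ (eigenspace Ω μ) := by
  have := finite_eigval_fiber ha μ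
  rw [h.eigenspace_eq_span ha]
  exact FiniteDimensional.span_of_finite ℝ (finite_range _)

lemma multiplicity_eq (ha : 0 < a) (μ : ℝ) :
    multiplicity Ω μ = Nat.card {p : Octant // eigval a p = μ} := by
  have := finite_eigval_fiber ha μ
  have := Fintype.ofFinite {p : Octant // eigval a p = μ}
  rw [multiplicity, h.eigenspace_eq_span ha, finrank_span_eq_card
    (h.linearIndependent_octantMode ha μ), Nat.card_eq_fintype_card]

end IsTriangleFrame

end Independence

end DirichletLaplacian

namespace DirichletLaplacian

open Set
open scoped Real

/-! ### Coordinates adapted to an isosceles right triangle. -/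

lemma isOpen_coord_triangle (O u v : Plane) :
    IsOpen {p | 0 < coord O v p ∧ coord O v p < coord O u p ∧ coord O u p < π} :=
  (isOpen_lt continuous_const (continuous_coord O v)).inter
    ((isOpen_lt (continuous_coord O v) (continuous_coord O u)).inter
      (isOpen_lt (continuous_coord O u) continuous_const))

lemma convex_coord_triangle (O u v : Plane) :
    Convex ℝ {p | 0 ≤ coord O v p ∧ coord O v p ≤ coord O u p ∧ coord O u p ≤ π} := by
  intro p hp q hq s t hs ht hst
  have e : ∀ w, coord O w (s • p + t • q) = s * coord O w p + t * coord O w q := fun w => by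
    have : s • p + t • q - O = s • (p - O) + t • (q - O) := by
      rw [smul_sub, smul_sub, sub_add_sub_comm, ← add_smul, hst, one_smul]
    rw [coord, this, inner_add_right, inner_smul_right, inner_smul_right, coord, coord]
  obtain ⟨h1, h2, h3⟩ := hp
  obtain ⟨k1, k2, k3⟩ := hq
  refine ⟨?_, ?_, ?_⟩ <;> simp only [e]
  · positivity
  · exact add_le_add (mul_le_mul_of_nonneg_left h2 hs) (mul_le_mul_of_nonneg_left k2 ht)
  · calc _ ≤ s * π + t * π :=
          add_le_add (mul_le_mul_of_nonneg_left h3 hs) (mul_le_mul_of_nonneg_left k3 ht)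
      _ = π := by rw [← add_mul, hst, one_mul]

/-- A point of the interior of a set remains in the set after a small move against `w`. -/
lemma exists_pos_add_smul_mem {s : Set Plane} {p : Plane} (hp : p ∈ interior s) (w : Plane) :
    ∃ t : ℝ, 0 < t ∧ p + (-t) • w ∈ s := by
  have hc : Tendsto (fun t : ℝ => p + (-t) • w) (𝓝[>] 0) (𝓝 p) := by
    have : Continuous fun t : ℝ => p + (-t) • w := by fun_prop
    simpa using (this.tendsto 0).mono_left nhdsWithin_le_nhds
  obtain ⟨t, ht, h0⟩ := ((hc.eventually (mem_interior_iff_mem_nhds.1 hp)).and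
    self_mem_nhdsWithin).exists
  exact ⟨t, h0, ht⟩

/-- With origin `B` and axes along `A - B` and `C - A`, the vertices `B`, `A`, `C` have coordinates
`(0, 0)`, `(π, 0)`, `(π, π)`. The scale `π / a²` makes each leg have coordinate length `π`. -/
lemma isTriangleFrame_triangle {a : ℝ} (ha : 0 < a) {A B C : Plane} (hB : dist A B = a)
    (hC : dist A C = a) (hA : ∠ B A C = π / 2) :
    IsTriangleFrame (triangle A B C) (π / a) B ((π / a / a) • (A - B)) ((π / a / a) • (C - A)) := by
  set c : ℝ := π / a / a with hc
  set u : Plane := c • (A - B) with hu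
  set v : Plane := c • (C - A) with hv
  have hπ := Real.pi_pos
  have hca : c * a ^ 2 = π := by rw [hc]; field_simp
  have hAB : inner ℝ (A - B) (A - B) = a ^ 2 := by
    rw [real_inner_self_eq_norm_sq, ← dist_eq_norm, hB]
  have hAC : inner ℝ (C - A) (C - A) = a ^ 2 := by
    rw [real_inner_self_eq_norm_sq, ← dist_eq_norm, dist_comm, hC]
  have hABC : inner ℝ (A - B) (C - A) = 0 := by
    have : inner ℝ (B - A) (C - A) = 0 :=
      InnerProductGeometry.inner_eq_zero_iff_angle_eq_pi_div_two _ _ |>.2 hA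
    rw [← neg_sub B A, inner_neg_left, this, neg_zero]
  have hBAC : inner ℝ (C - A) (A - B) = 0 := by rw [real_inner_comm, hABC]
  have huu : inner ℝ u u = (π / a) ^ 2 := by
    rw [hu, inner_smul_left, inner_smul_right, hAB, conj_trivial, hc]; field_simp
  have hvv : inner ℝ v v = (π / a) ^ 2 := by
    rw [hv, inner_smul_left, inner_smul_right, hAC, conj_trivial, hc]; field_simp
  have huv : inner ℝ u v = 0 := by
    rw [hu, hv, inner_smul_left, inner_smul_right, hABC]; simp
  have hvu : inner ℝ v u = 0 := by rw [real_inner_comm, huv]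
  have hF : IsTriangleFrame ⟨_, isOpen_coord_triangle B u v⟩ (π / a) B u v :=
    ⟨by positivity, huu, hvv, huv, fun _ => Iff.rfl⟩
  have hκ : 0 < (π / a) ^ 2 := by positivity
  have hCB : C - B = (A - B) + (C - A) := by abel
  have uA : coord B u A = π := by
    rw [coord, hu, inner_smul_left, hAB, conj_trivial, hca]
  have vA : coord B v A = 0 := by
    rw [coord, hv, inner_smul_left, hBAC, mul_zero]
  have uB : coord B u B = 0 := by simp [coord]
  have vB : coord B v B = 0 := by simp [coord]
  have uC : coord B u C = π := by
    rw [coord, hCB, hu, inner_smul_left, inner_add_right, hAB, hABC, conj_trivial, add_zero, hca]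
  have vC : coord B v C = π := by
    rw [coord, hCB, hv, inner_smul_left, inner_add_right, hAC, hBAC, conj_trivial, zero_add, hca]
  have hsub : convexHull ℝ {A, B, C} ⊆
      {p | 0 ≤ coord B v p ∧ coord B v p ≤ coord B u p ∧ coord B u p ≤ π} := by
    refine convexHull_min ?_ (convex_coord_triangle B u v)
    rintro p (rfl | rfl | rfl)
    · exact ⟨vA.ge, by rw [vA, uA]; exact hπ.le, uA.le⟩
    · exact ⟨vB.ge, by rw [vB, uB], by rw [uB]; exact hπ.le⟩
    · exact ⟨by rw [vC]; exact hπ.le, by rw [vC, uC], uC.le⟩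
  refine ⟨by positivity, huu, hvv, huv, fun p => ⟨fun hp => ?_, fun hp => ?_⟩⟩
  · change p ∈ interior _ at hp
    -- Each weak inequality of the closed triangle is strict at an interior point, since a small
    -- move in the direction that worsens it stays inside the hull.
    refine ⟨?_, ?_, ?_⟩
    · obtain ⟨t, ht, hm⟩ := exists_pos_add_smul_mem hp v
      have := (hsub hm).1
      rw [coord_add_smul, hvv] at this
      nlinarith [mul_pos ht hκ]
    · obtain ⟨t, ht, hm⟩ := exists_pos_add_smul_mem hp (u - v)
      have := (hsub hm).2.1
      rw [coord_add_smul, coord_add_smul, inner_sub_right, inner_sub_right, hvv, huu, huv, hvu]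
        at this
      nlinarith [mul_pos ht hκ]
    · obtain ⟨t, ht, hm⟩ := exists_pos_add_smul_mem hp (-u)
      have := (hsub hm).2.2
      rw [coord_add_smul, inner_neg_right, huu] at this
      nlinarith [mul_pos ht hκ]
  · refine interior_maximal ?_ (isOpen_coord_triangle B u v) hp
    rintro q ⟨h1, h2, h3⟩
    set x := coord B u q with hx
    set y := coord B v q with hy
    -- The point is reached by two convex combinations: go from `A` towards `C` by the ratio `y /
    -- x`, then from `B` towards that point by the ratio `x / π`.
    have hmem := (convex_convexHull ℝ {A, B, C}).add_smul_sub_mem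
      (subset_convexHull ℝ {A, B, C} (by simp : B ∈ ({A, B, C} : Set Plane)))
      ((convex_convexHull ℝ {A, B, C}).add_smul_sub_mem
        (subset_convexHull ℝ {A, B, C} (by simp : A ∈ ({A, B, C} : Set Plane)))
        (subset_convexHull ℝ {A, B, C} (by simp : C ∈ ({A, B, C} : Set Plane)))
        (t := y / x) ⟨by have := h1.trans h2; positivity, (div_le_one (h1.trans h2)).2 h2.le⟩)
      (t := x / π) ⟨by have := h1.trans h2; positivity, (div_le_one hπ).2 h3.le⟩
    have hx0 : x ≠ 0 := (h1.trans h2).ne'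
    have key : ∀ w, coord B w (B + (x / π) • (A + (y / x) • (C - A) - B)) =
        x / π * (coord B w A + y / x * inner ℝ w (C - A)) := fun w => by
      rw [← coord_add_smul, coord, coord, add_sub_cancel_left, inner_smul_right]
    have uCA : inner ℝ u (C - A) = 0 := by rw [hu, inner_smul_left, hABC, mul_zero]
    have vCA : inner ℝ v (C - A) = π := by rw [hv, inner_smul_left, hAC, conj_trivial, hca]
    convert hmem using 1
    refine hF.eq_of_coord_eq ?_ ?_
    · rw [key, uA, uCA, ← hx]; field_simp; ring
    · rw [key, vA, vCA, ← hy]; field_simp; ring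

end DirichletLaplacian

theorem mainTheorem9 (a : ℝ) (ha : 0 < a) (A B C : DirichletLaplacian.Plane)
    (hB : dist A B = a) (hC : dist A C = a) (hA : ∠ B A C = Real.pi / 2) :
    -- the spectral zeta function is well defined and regular at `0`
    (∀ μ : ℝ, FiniteDimensional ℝ
      (DirichletLaplacian.eigenspace (DirichletLaplacian.triangle A B C) μ)) ∧
    (∀ μ ∈ DirichletLaplacian.spectrum (DirichletLaplacian.triangle A B C), 0 < μ) ∧
    (∃! Z : ℂ → ℂ, DirichletLaplacian.IsSpectralZeta (DirichletLaplacian.triangle A B C) Z) ∧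
    AnalyticAt ℂ (DirichletLaplacian.spectralZeta (DirichletLaplacian.triangle A B C)) 0 ∧
    -- the first expression
    Summable (fun n : ℕ+ =>
      1 / ((n : ℝ) * Real.exp (2 * Real.pi * n)) * ∑ d ∈ (n : ℕ).divisors, (d : ℝ)) ∧
    deriv (DirichletLaplacian.spectralZeta (DirichletLaplacian.triangle A B C)) 0 =
      ((Real.log (4 * a ^ 3) / 4 + Real.pi / 24 + 1 / 2 * ∑' n : ℕ+,
        1 / ((n : ℝ) * Real.exp (2 * Real.pi * n)) * ∑ d ∈ (n : ℕ).divisors, (d : ℝ) : ℝ) : ℂ) ∧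
    -- the second expression
    deriv (DirichletLaplacian.spectralZeta (DirichletLaplacian.triangle A B C)) 0 =
      ((1 / 4 * Real.log (4 * a ^ 3 / ‖ModularForm.eta Complex.I‖ ^ 2) : ℝ) : ℂ) ∧
    Summable (fun n : ℕ+ => Real.log (1 - Real.exp (-2 * Real.pi * n))) ∧
    deriv (DirichletLaplacian.spectralZeta (DirichletLaplacian.triangle A B C)) 0 =
      ((Real.log (4 * a ^ 3) / 4 + Real.pi / 24 -
        1 / 2 * ∑' n : ℕ+, Real.log (1 - Real.exp (-2 * Real.pi * n)) : ℝ) : ℂ) ∧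
    -- the zeta-regularized determinant
    DirichletLaplacian.zetaDet (DirichletLaplacian.triangle A B C) =
      Complex.exp
        (-deriv (DirichletLaplacian.spectralZeta (DirichletLaplacian.triangle A B C)) 0) ∧
    DirichletLaplacian.zetaDet (DirichletLaplacian.triangle A B C) =
      ((Real.exp (-(1 / 4 * Real.log (4 * a ^ 3 / ‖ModularForm.eta Complex.I‖ ^ 2))) : ℝ) : ℂ) := by
  have h := DirichletLaplacian.isTriangleFrame_triangle ha hB hC hA
  have hfin := h.finiteDimensional_eigenspace ha
  have hm := h.multiplicity_eq ha
  have hev := DirichletLaplacian.spectralZeta_eventuallyEq ha hm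
  have hd := hev.deriv_eq.trans (DirichletLaplacian.deriv_triangleZeta_zero ha)
  have hs₁ := DirichletLaplacian.hasSum_lambert_divisors
  have hs₂ := DirichletLaplacian.hasSum_lambert_log
  have hη : 0 < ‖ModularForm.eta Complex.I‖ := norm_pos_iff.2
    (ModularForm.eta_ne_zero (by simp [UpperHalfPlane.upperHalfPlaneSet]))
  have hd₂ : deriv (DirichletLaplacian.spectralZeta (DirichletLaplacian.triangle A B C)) 0 =
      ((1 / 4 * Real.log (4 * a ^ 3 / ‖ModularForm.eta Complex.I‖ ^ 2) : ℝ) : ℂ) := by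
    -- Here `-(1/2) log ‖η(i)‖` equals `π/24` plus half of the Lambert sum.
    rw [hd, Real.log_div (by positivity) (by positivity), Real.log_pow,
      DirichletLaplacian.log_norm_eta_I]
    congr 1
    push_cast
    ring
  refine ⟨hfin, fun μ hμ => ?_, ⟨_, DirichletLaplacian.isSpectralZeta_toMeromorphicNFOn ha hm,
    fun Z hZ => hZ.unique (DirichletLaplacian.isSpectralZeta_toMeromorphicNFOn ha hm)⟩,
    (DirichletLaplacian.analyticAt_triangleZeta ha (by norm_num) (by norm_num)).congr hev.symm,
    hs₁.summable, ?_, hd₂, hs₂.summable, ?_, rfl, ?_⟩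
  · obtain ⟨p, rfl⟩ := (DirichletLaplacian.mem_spectrum_iff ha hm μ).1 hμ
    exact DirichletLaplacian.eigval_pos ha p
  · rw [hd, hs₁.tsum_eq]
  · rw [hd, hs₂.tsum_eq]
    congr 1
    ring
  · rw [DirichletLaplacian.zetaDet, hd₂, ← Complex.ofReal_neg, ← Complex.ofReal_exp]
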